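/- Let $M$ be a smooth manifold (Hausdorff, second countable) of dimension $n\ge 2$. For a smooth torsion-free connection $\nabla$ on $TM$, with curvature $R(X,Y)Z=\nabla_X\nabla_YZ-\nabla_Y\nabla_XZ-\nabla_{[X,Y]}Z$, let $R_{ab}$ be its Ricci tensor, $\mathrm{Ric}(Y,Z)=\operatorname{tr}(X\mapsto R(X,Y)Z)$, i.e. $(\nabla_b\nabla_a-\nabla_a\nabla_b)X^b=R_{ab}X^b$. The projective Schouten tensor $\mathrm P_{ab}$ of $\nabla$ and its skew part $\beta_{ab}$ are defined by $$R_{ab}=(n-1)\mathrm P_{ab}-\beta_{ab},\qquad \beta_{ab}=\mathrm P_{ba}-\mathrm P_{ab};$$ equivalently $\mathrm P_{ab}=\frac{1}{n^2-1}\,(nR_{ab}+R_{ba})$. Two smooth torsion-free connections are projectively equivalent if they have the same geodesics as unparameterised curves, and a projective class is an equivalence class of this relation. Then: 1. For every smooth torsion-free connection $\nabla$, $\beta$ is a smooth closed $2$-form on $M$. 2. If two smooth torsion-free connections $\nabla,\hat\nabla$ and a smooth $1$-form $\Upsilon_a$ satisfy $\hat\nabla_aX^b=\nabla_aX^b+\Upsilon_aX^b+\delta_a{}^b\Upsilon_cX^c$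 for all vector fields $X^b$, then $\hat\beta=\beta+d\Upsilon$, where $(d\Upsilon)_{ab}=\nabla_a\Upsilon_b-\nabla_b\Upsilon_a$. 3. If $\nabla$ and $\hat\nabla$ are projectively equivalent, then there is a smooth $1$-form $\Upsilon$ related to them as in 2, with $\hat\beta=\beta+d\Upsilon$. In particular $\hat\beta-\beta$ is exact and $[\hat\beta]=[\beta]$ in the de Rham cohomology $H^2(M,\mathbb R)$, so that $[\beta]\in H^2(M,\mathbb R)$ depends only on the projective class. 4. If the projective class of $\nabla$ contains a metric connection, i.e. the Levi-Civita connection of some smooth Riemannian metric on $M$, then $[\beta]=0$ in $H^2(M,\mathbb R)$. -/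

import Mathlib

open Set Bundle VectorField FiberBundle
open scoped Manifold ContDiff Topology

noncomputable section

/-! ### Differential forms on an `n`-manifold and de Rham cohomology -/

section Forms

variable (n : ℕ) (M : Type*) [TopologicalSpace M] [ChartedSpace (EuclideanSpace ℝ (Fin n)) M]

/-- Not necessarily smooth `k`-forms on `M`: an alternating `k`-linear form on each tangent
space. -/
def FormField (k : ℕ) : Type _ :=
  (x : M) → (TangentSpace (𝓡 n) x) [⋀^Fin k]→L[ℝ] ℝ

/-- Forms are added pointwise. -/
instance (k : ℕ) : AddCommGroup (FormField n M k) :=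
  inferInstanceAs (AddCommGroup ((x : M) → (TangentSpace (𝓡 n) x) [⋀^Fin k]→L[ℝ] ℝ))

/-- Forms are multiplied by scalars pointwise. -/
instance (k : ℕ) : Module ℝ (FormField n M k) :=
  inferInstanceAs (Module ℝ ((x : M) → (TangentSpace (𝓡 n) x) [⋀^Fin k]→L[ℝ] ℝ))

variable {n M}

theorem FormField.add_apply {k : ℕ} (α η : FormField n M k) (x : M) :
    (α + η) x = α x + η x := rfl

theorem FormField.smul_apply {k : ℕ} (c : ℝ) (α : FormField n M k) (x : M) :
    (c • α) x = c • α x := rfl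

/-- The coordinate expression of a `k`-form in the chart of `M` centred at `x₀`, i.e. its pullback
under the inverse of the chart. It is meaningful on the target of the chart. -/
def formInChart {k : ℕ} (α : FormField n M k) (x₀ : M) (y : EuclideanSpace ℝ (Fin n)) :
    (EuclideanSpace ℝ (Fin n)) [⋀^Fin k]→L[ℝ] ℝ :=
  (α ((extChartAt (𝓡 n) x₀).symm y)).compContinuousLinearMap
    (mfderiv 𝓘(ℝ, EuclideanSpace ℝ (Fin n)) (𝓡 n) (extChartAt (𝓡 n) x₀).symm y)

theorem formInChart_add {k : ℕ} (α η : FormField n M k) (x₀ : M) :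
    formInChart (α + η) x₀ = formInChart α x₀ + formInChart η x₀ := rfl

theorem formInChart_smul {k : ℕ} (c : ℝ) (α : FormField n M k) (x₀ : M) :
    formInChart (c • α) x₀ = c • formInChart α x₀ := rfl

theorem formInChart_zero {k : ℕ} (x₀ : M) :
    formInChart (0 : FormField n M k) x₀ = 0 := rfl

variable (n M) in
/-- The space `Ω^k(M)` of smooth `k`-forms: those with smooth coordinate expressions. -/
def smoothForms (k : ℕ) : Submodule ℝ (FormField n M k) where
  carrier := {α | ∀ x₀ : M, ContDiffOn ℝ ∞ (formInChart α x₀) (extChartAt (𝓡 n) x₀).target}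
  add_mem' := by
    intro α η hα hη x₀
    rw [formInChart_add]
    exact (hα x₀).add (hη x₀)
  zero_mem' := by
    intro x₀
    rw [formInChart_zero]
    exact contDiffOn_const
  smul_mem' := by
    intro c α hα x₀
    rw [formInChart_smul]
    exact contDiffOn_const.smul (hα x₀)

theorem differentiableAt_formInChart {k : ℕ} {α : FormField n M k} (hα : α ∈ smoothForms n M k)
    (x : M) : DifferentiableAt ℝ (formInChart α x) (extChartAt (𝓡 n) x x) :=
  ((hα x).contDiffAt (extChartAt_target_mem_nhds x)).differentiableAt (by simp)

/-- The exterior derivative: at the point `x` it is computed in the chart centred at `x`, with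
`(dα)(X₀, …, X_k) = ∑ (-1)^i X_i α(X₀, …, X̂_i, …, X_k)` for coordinate vector fields, so that
`(dΥ)_{ab} = ∂_a Υ_b - ∂_b Υ_a` for a `1`-form. -/
def formExtDeriv {k : ℕ} (α : FormField n M k) : FormField n M (k + 1) := fun x ↦
  (extDeriv (formInChart α x) (extChartAt (𝓡 n) x x)).compContinuousLinearMap
    (mfderiv (𝓡 n) 𝓘(ℝ, EuclideanSpace ℝ (Fin n)) (extChartAt (𝓡 n) x) x)

theorem formExtDeriv_add {k : ℕ} {α η : FormField n M k} (hα : α ∈ smoothForms n M k)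
    (hη : η ∈ smoothForms n M k) :
    formExtDeriv (α + η) = formExtDeriv α + formExtDeriv η := by
  funext x
  simp only [formExtDeriv, formInChart_add, FormField.add_apply]
  rw [extDeriv_add (differentiableAt_formInChart hα x) (differentiableAt_formInChart hη x)]
  rfl

theorem formExtDeriv_smul {k : ℕ} (c : ℝ) (α : FormField n M k) :
    formExtDeriv (c • α) = c • formExtDeriv α := by
  funext x
  simp only [formExtDeriv, formInChart_smul, FormField.smul_apply]
  rw [extDeriv_smul]
  rfl

theorem formExtDeriv_zero {k : ℕ} : formExtDeriv (0 : FormField n M k) = 0 := by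
  simpa using formExtDeriv_smul (0 : ℝ) (0 : FormField n M k)

variable (n M) in
/-- The space of closed smooth `k`-forms. -/
def closedForms (k : ℕ) : Submodule ℝ (FormField n M k) where
  carrier := {α | α ∈ smoothForms n M k ∧ formExtDeriv α = 0}
  add_mem' := by
    rintro α η ⟨hα, hα'⟩ ⟨hη, hη'⟩
    exact ⟨add_mem hα hη, by rw [formExtDeriv_add hα hη, hα', hη', add_zero]⟩
  zero_mem' := ⟨zero_mem _, formExtDeriv_zero⟩
  smul_mem' := by
    rintro c α ⟨hα, hα'⟩
    exact ⟨Submodule.smul_mem _ c hα, by rw [formExtDeriv_smul, hα', smul_zero]⟩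

variable (n M) in
/-- The space of exact `(k+1)`-forms: the exterior derivatives of smooth `k`-forms. -/
def exactForms (k : ℕ) : Submodule ℝ (FormField n M (k + 1)) where
  carrier := {α | ∃ η ∈ smoothForms n M k, formExtDeriv η = α}
  add_mem' := by
    rintro _ _ ⟨η, hη, rfl⟩ ⟨θ, hθ, rfl⟩
    exact ⟨η + θ, add_mem hη hθ, formExtDeriv_add hη hθ⟩
  zero_mem' := ⟨0, zero_mem _, formExtDeriv_zero⟩
  smul_mem' := by
    rintro c _ ⟨η, hη, rfl⟩
    exact ⟨c • η, Submodule.smul_mem _ c hη, formExtDeriv_smul c η⟩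

variable (n M) in
/-- The de Rham cohomology group `H^{k+1}(M, ℝ)`: closed `(k+1)`-forms modulo exact ones. -/
abbrev DeRhamCohomologySucc (k : ℕ) : Type _ :=
  (closedForms n M (k + 1)) ⧸ (exactForms n M k).comap (closedForms n M (k + 1)).subtype

/-- The cohomology class in `H²(M, ℝ)` of a closed `2`-form. -/
def deRhamClass (α : FormField n M 2) (hα : α ∈ closedForms n M 2) :
    DeRhamCohomologySucc n M 1 :=
  Submodule.Quotient.mk ⟨α, hα⟩

end Forms

/-! ### Smooth torsion-free connections and their curvature -/

section Connections

variable (n : ℕ) (M : Type*) [TopologicalSpace M] [ChartedSpace (EuclideanSpace ℝ (Fin n)) M]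
  [IsManifold (𝓡 n) ∞ M]

/-- A smooth torsion-free connection on the tangent bundle of `M`. In Mathlib's notation
`cov Y x u` is `(∇_u Y)(x)`. -/
structure TorsionFreeConnection where
  cov : CovariantDerivative (𝓡 n) (EuclideanSpace ℝ (Fin n)) (TangentSpace (𝓡 n) : M → Type _)
  smooth : CovariantDerivative.ContMDiffCovariantDerivative cov ∞
  torsion_eq_zero : cov.torsion = 0

variable {n M}

/-- The vector field `Z` is smooth on the set `u`. -/
abbrev SmoothFieldOn (Z : (x : M) → TangentSpace (𝓡 n) x) (u : Set M) : Prop :=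
  ContMDiffOn (𝓡 n) ((𝓡 n).prod 𝓘(ℝ, EuclideanSpace ℝ (Fin n))) ∞
    (fun y ↦ TotalSpace.mk' (EuclideanSpace ℝ (Fin n)) y (Z y)) u

/-- The vector field `Z` is differentiable at the point `x`. -/
abbrev DifferentiableFieldAt (Z : (x : M) → TangentSpace (𝓡 n) x) (x : M) : Prop :=
  MDifferentiableAt (𝓡 n) ((𝓡 n).prod 𝓘(ℝ, EuclideanSpace ℝ (Fin n)))
    (fun y ↦ TotalSpace.mk' (EuclideanSpace ℝ (Fin n)) y (Z y)) x

namespace TorsionFreeConnection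

variable (D : TorsionFreeConnection n M)

/-- `∇_X ∇_Y Z - ∇_Y ∇_X Z - ∇_{[X,Y]} Z` at the point `x`. -/
def curvatureField (X Y Z : (x : M) → TangentSpace (𝓡 n) x) (x : M) : TangentSpace (𝓡 n) x :=
  D.cov (fun y ↦ D.cov Z y (Y y)) x (X x) - D.cov (fun y ↦ D.cov Z y (X y)) x (Y x)
    - D.cov Z x (mlieBracket (𝓡 n) X Y x)

theorem contMDiffAt_cov [T2Space M] {Z : (x : M) → TangentSpace (𝓡 n) x} {x : M}
    {u : Set M} (hu : u ∈ 𝓝 x) (hZ : SmoothFieldOn Z u) :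
    ContMDiffAt (𝓡 n)
      ((𝓡 n).prod 𝓘(ℝ, EuclideanSpace ℝ (Fin n) →L[ℝ] EuclideanSpace ℝ (Fin n))) ∞
      (fun y ↦ TotalSpace.mk' (EuclideanSpace ℝ (Fin n) →L[ℝ] EuclideanSpace ℝ (Fin n))
        (E := fun y : M ↦ TangentSpace (𝓡 n) y →L[ℝ] TangentSpace (𝓡 n) y) y (D.cov Z y)) x := by
  obtain ⟨v, hvu, hvo, hxv⟩ := mem_nhds_iff.1 hu
  obtain ⟨f, hf, -⟩ := (SmoothBumpFunction.nhds_basis_support (I := 𝓡 n)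
    (hvo.mem_nhds hxv)).mem_iff.1 (hvo.mem_nhds hxv)
  have hv : SmoothFieldOn Z v := hZ.mono hvu
  have h1 : ContMDiff (𝓡 n) ((𝓡 n).prod 𝓘(ℝ, EuclideanSpace ℝ (Fin n))) ∞
      (fun y ↦ TotalSpace.mk' (EuclideanSpace ℝ (Fin n)) y (((f : M → ℝ) • Z) y)) :=
    ContMDiffOn.smul_section_of_tsupport f.contMDiff.contMDiffOn hvo hf hv
  have h2 := (D.smooth.contMDiff.contMDiff (σ := (f : M → ℝ) • Z)
    (by simpa using h1.contMDiffOn)).contMDiffAt (x := x) Filter.univ_mem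
  refine h2.congr_of_eventuallyEq ?_
  filter_upwards [f.eventuallyEq_one.eventually_nhds, hvo.mem_nhds hxv] with y hy hyv
  have hZy : DifferentiableFieldAt Z y := (hv.contMDiffAt (hvo.mem_nhds hyv)).mdifferentiableAt (by simp)
  have hfZy : DifferentiableFieldAt ((f : M → ℝ) • Z) y := h1.contMDiffAt.mdifferentiableAt (by simp)
  have : D.cov Z y = D.cov ((f : M → ℝ) • Z) y :=
    D.cov.isCovariantDerivativeOnUniv.congr_of_eventuallyEq hZy hfZy Filter.univ_mem
      (by filter_upwards [hy] with z hz; simp [hz])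
  rw [this]

theorem mdifferentiableAt_cov_apply [T2Space M] {Z Y : (x : M) → TangentSpace (𝓡 n) x} {x : M}
    {u : Set M} (hu : u ∈ 𝓝 x) (hZ : SmoothFieldOn Z u) (hY : DifferentiableFieldAt Y x) :
    DifferentiableFieldAt (fun y ↦ D.cov Z y (Y y)) x :=
  MDifferentiableAt.clm_bundle_apply (b := fun y ↦ y)
    ((D.contMDiffAt_cov hu hZ).mdifferentiableAt (by simp)) hY

theorem tensorialAt_curvatureField₁ [T2Space M] {Z : (x : M) → TangentSpace (𝓡 n) x} {x : M}
    {u : Set M} (hu : u ∈ 𝓝 x) (hZ : SmoothFieldOn Z u) (Y : (x : M) → TangentSpace (𝓡 n) x) :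
    TensorialAt (𝓡 n) (EuclideanSpace ℝ (Fin n)) (D.curvatureField · Y Z x) x where
  smul {f X} hf hX := by
    have h := D.cov.isCovariantDerivativeOnUniv.leibniz (D.mdifferentiableAt_cov_apply hu hZ hX) hf
    have e : (fun y ↦ D.cov Z y ((f • X) y)) = f • (fun y ↦ D.cov Z y (X y)) := by
      funext y; simp
    simp only [curvatureField]
    rw [e, h, mlieBracket_smul_left hf hX]
    simp
    module
  add {X X'} hX hX' := by
    have h := D.cov.isCovariantDerivativeOnUniv.add (D.mdifferentiableAt_cov_apply hu hZ hX)
      (D.mdifferentiableAt_cov_apply hu hZ hX')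
    have e : (fun y ↦ D.cov Z y ((X + X') y)) =
        (fun y ↦ D.cov Z y (X y)) + (fun y ↦ D.cov Z y (X' y)) := by
      funext y; simp
    simp only [curvatureField]
    rw [e, h, mlieBracket_add_left hX hX']
    simp
    module

theorem curvatureField_swap (X Y Z : (x : M) → TangentSpace (𝓡 n) x) (x : M) :
    D.curvatureField X Y Z x = - D.curvatureField Y X Z x := by
  simp only [curvatureField]
  rw [mlieBracket_swap_apply]
  simp
  module

theorem tensorialAt_curvatureField₂ [T2Space M] {Z : (x : M) → TangentSpace (𝓡 n) x} {x : M}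
    {u : Set M} (hu : u ∈ 𝓝 x) (hZ : SmoothFieldOn Z u) (X : (x : M) → TangentSpace (𝓡 n) x) :
    TensorialAt (𝓡 n) (EuclideanSpace ℝ (Fin n)) (D.curvatureField X · Z x) x where
  smul {f Y} hf hY := by
    simp only [D.curvatureField_swap X]
    rw [(D.tensorialAt_curvatureField₁ hu hZ X).smul hf hY, smul_neg]
  add {Y Y'} hY hY' := by
    simp only [D.curvatureField_swap X]
    rw [(D.tensorialAt_curvatureField₁ hu hZ X).add hY hY', neg_add]

/-- The vector field near `x` with constant components `w` in the chart centred at `x` (and value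
`0` outside the domain of that chart). -/
def coordField {x : M} (w : TangentSpace (𝓡 n) x) : (y : M) → TangentSpace (𝓡 n) y := fun y ↦
  (trivializationAt (EuclideanSpace ℝ (Fin n)) (TangentSpace (𝓡 n) : M → Type _) x).symmL ℝ y
    ((trivializationAt (EuclideanSpace ℝ (Fin n))
      (TangentSpace (𝓡 n) : M → Type _) x).continuousLinearMapAt ℝ x w)

theorem coordField_add {x : M} (w w' : TangentSpace (𝓡 n) x) :
    coordField (w + w') = coordField w + coordField w' := by
  funext y
  simp only [coordField, map_add, Pi.add_apply]

theorem coordField_smul {x : M} (c : ℝ) (w : TangentSpace (𝓡 n) x) :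
    coordField (c • w) = c • coordField w := by
  funext y
  simp only [coordField, map_smul, Pi.smul_apply]

theorem coordField_self {x : M} (w : TangentSpace (𝓡 n) x) : coordField w x = w :=
  Trivialization.symmL_continuousLinearMapAt _ (mem_baseSet_trivializationAt' x) w

theorem exists_smoothFieldOn_coordField {x : M} (w : TangentSpace (𝓡 n) x) :
    ∃ u ∈ 𝓝 x, SmoothFieldOn (coordField w) u := by
  obtain ⟨u, hu, h⟩ := exists_contMDiffOn_extend (k := ∞) (𝓡 n) (EuclideanSpace ℝ (Fin n)) w
  have hx := mem_baseSet_trivializationAt' (F := EuclideanSpace ℝ (Fin n))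
    (E := (TangentSpace (𝓡 n) : M → Type _)) x
  refine ⟨u ∩ (trivializationAt (EuclideanSpace ℝ (Fin n))
      (TangentSpace (𝓡 n) : M → Type _) x).baseSet,
    Filter.inter_mem hu ((Trivialization.open_baseSet _).mem_nhds hx),
    (h.mono inter_subset_left).congr ?_⟩
  rintro y ⟨-, hy⟩
  simp only [coordField, extend]
  rw [Trivialization.symmL_apply _ hy, Trivialization.continuousLinearMapAt_apply,
    Trivialization.coe_linearMapAt_of_mem _ hx]

theorem differentiableFieldAt_coordField {x : M} (w : TangentSpace (𝓡 n) x) :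
    DifferentiableFieldAt (coordField w) x := by
  obtain ⟨u, hu, h⟩ := exists_smoothFieldOn_coordField w
  exact (h.contMDiffAt hu).mdifferentiableAt (by simp)

theorem curvatureField_add [T2Space M] {X Y Z Z' : (x : M) → TangentSpace (𝓡 n) x} {x : M}
    {u : Set M} (hu : u ∈ 𝓝 x) (hZ : SmoothFieldOn Z u) (hZ' : SmoothFieldOn Z' u)
    (hX : DifferentiableFieldAt X x) (hY : DifferentiableFieldAt Y x) :
    D.curvatureField X Y (Z + Z') x = D.curvatureField X Y Z x + D.curvatureField X Y Z' x := by
  have hD := D.cov.isCovariantDerivativeOnUniv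
  have hZd : ∀ y ∈ interior u, DifferentiableFieldAt Z y := fun y hy ↦
    (hZ.contMDiffAt (mem_interior_iff_mem_nhds.1 hy)).mdifferentiableAt (by simp)
  have hZd' : ∀ y ∈ interior u, DifferentiableFieldAt Z' y := fun y hy ↦
    (hZ'.contMDiffAt (mem_interior_iff_mem_nhds.1 hy)).mdifferentiableAt (by simp)
  have hs : SmoothFieldOn (Z + Z') u := hZ.add_section hZ'
  have step : ∀ W : (x : M) → TangentSpace (𝓡 n) x, DifferentiableFieldAt W x →
      D.cov (fun y ↦ D.cov (Z + Z') y (W y)) x =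
        D.cov (fun y ↦ D.cov Z y (W y)) x + D.cov (fun y ↦ D.cov Z' y (W y)) x := by
    intro W hW
    have h1 := D.mdifferentiableAt_cov_apply hu hZ hW
    have h2 := D.mdifferentiableAt_cov_apply hu hZ' hW
    rw [← hD.add h1 h2]
    refine hD.congr_of_eventuallyEq (D.mdifferentiableAt_cov_apply hu hs hW)
      (mdifferentiableAt_add_section h1 h2) Filter.univ_mem ?_
    filter_upwards [interior_mem_nhds.2 hu] with y hy
    simp [hD.add (hZd y hy) (hZd' y hy)]
  have hx := mem_interior_iff_mem_nhds.2 hu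
  simp only [curvatureField]
  rw [step X hX, step Y hY, hD.add (hZd x hx) (hZd' x hx)]
  simp
  module

theorem curvatureField_smul [T2Space M] (c : ℝ) {X Y Z : (x : M) → TangentSpace (𝓡 n) x} {x : M}
    {u : Set M} (hu : u ∈ 𝓝 x) (hZ : SmoothFieldOn Z u)
    (hX : DifferentiableFieldAt X x) (hY : DifferentiableFieldAt Y x) :
    D.curvatureField X Y (c • Z) x = c • D.curvatureField X Y Z x := by
  have hD := D.cov.isCovariantDerivativeOnUniv
  have hZd : ∀ y ∈ interior u, DifferentiableFieldAt Z y := fun y hy ↦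
    (hZ.contMDiffAt (mem_interior_iff_mem_nhds.1 hy)).mdifferentiableAt (by simp)
  have hs : SmoothFieldOn (c • Z) u := hZ.const_smul_section
  have step : ∀ W : (x : M) → TangentSpace (𝓡 n) x, DifferentiableFieldAt W x →
      D.cov (fun y ↦ D.cov (c • Z) y (W y)) x = c • D.cov (fun y ↦ D.cov Z y (W y)) x := by
    intro W hW
    have h1 := D.mdifferentiableAt_cov_apply hu hZ hW
    rw [← hD.smul_const c h1]
    refine hD.congr_of_eventuallyEq (D.mdifferentiableAt_cov_apply hu hs hW)
      (mdifferentiableAt_const.smul_section h1) Filter.univ_mem ?_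
    filter_upwards [interior_mem_nhds.2 hu] with y hy
    simp [hD.smul_const c (hZd y hy)]
  have hx := mem_interior_iff_mem_nhds.2 hu
  simp only [curvatureField]
  rw [step X hX, step Y hY, hD.smul_const c (hZd x hx)]
  simp
  module

variable [T2Space M]

/-- The curvature `(u, v) ↦ R(u, v) w` at `x`, i.e. `∇_X ∇_Y Z - ∇_Y ∇_X Z - ∇_{[X,Y]} Z` for any
differentiable fields `X`, `Y` with `X x = u`, `Y x = v`, where `Z` is the field extending `w` with
constant components in the chart centred at `x`. -/
def curvature {x : M} (w : TangentSpace (𝓡 n) x) :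
    TangentSpace (𝓡 n) x →L[ℝ] TangentSpace (𝓡 n) x →L[ℝ] TangentSpace (𝓡 n) x :=
  TensorialAt.mkHom₂ (I := 𝓡 n) (F := EuclideanSpace ℝ (Fin n)) (F' := EuclideanSpace ℝ (Fin n))
    (fun X Y ↦ D.curvatureField X Y (coordField w) x) x
    (fun Y _ ↦ by
      obtain ⟨u, hu, hw⟩ := exists_smoothFieldOn_coordField w
      exact D.tensorialAt_curvatureField₁ hu hw Y)
    (fun X _ ↦ by
      obtain ⟨u, hu, hw⟩ := exists_smoothFieldOn_coordField w
      exact D.tensorialAt_curvatureField₂ hu hw X)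

theorem curvature_apply {x : M} (w : TangentSpace (𝓡 n) x)
    {X Y : (x : M) → TangentSpace (𝓡 n) x}
    (hX : DifferentiableFieldAt X x) (hY : DifferentiableFieldAt Y x) :
    D.curvature w (X x) (Y x) = D.curvatureField X Y (coordField w) x :=
  TensorialAt.mkHom₂_apply _ _ hX hY

theorem curvature_eq_coordField {x : M} (u v w : TangentSpace (𝓡 n) x) :
    D.curvature w u v = D.curvatureField (coordField u) (coordField v) (coordField w) x := by
  have h := D.curvature_apply w (differentiableFieldAt_coordField u)
    (differentiableFieldAt_coordField v)
  rwa [coordField_self, coordField_self] at h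

theorem curvature_add {x : M} (w w' : TangentSpace (𝓡 n) x) :
    D.curvature (w + w') = D.curvature w + D.curvature w' := by
  ext1 u
  ext1 v
  obtain ⟨s, hs, hw⟩ := exists_smoothFieldOn_coordField w
  obtain ⟨s', hs', hw'⟩ := exists_smoothFieldOn_coordField w'
  have := D.curvatureField_add (Filter.inter_mem hs hs') (hw.mono inter_subset_left)
    (hw'.mono inter_subset_right)
    (differentiableFieldAt_coordField u)
    (differentiableFieldAt_coordField v)
  rw [← coordField_add] at this
  simpa only [curvature_eq_coordField, add_apply] using this

theorem curvature_smul {x : M} (c : ℝ) (w : TangentSpace (𝓡 n) x) :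
    D.curvature (c • w) = c • D.curvature w := by
  ext1 u
  ext1 v
  obtain ⟨s, hs, hw⟩ := exists_smoothFieldOn_coordField w
  have := D.curvatureField_smul c hs hw
    (differentiableFieldAt_coordField u)
    (differentiableFieldAt_coordField v)
  rw [← coordField_smul] at this
  simpa only [curvature_eq_coordField, smul_apply] using this

/-- The endomorphism `u ↦ R(u, v) w` of the tangent space at `x`. -/
def curvatureEnd {x : M} (v w : TangentSpace (𝓡 n) x) :
    TangentSpace (𝓡 n) x →ₗ[ℝ] TangentSpace (𝓡 n) x where
  toFun u := D.curvature w u v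
  map_add' u u' := by rw [map_add]; rfl
  map_smul' c u := by rw [map_smul]; rfl

/-- The Ricci tensor `R_{ab}`, as the bilinear form `Ric(v, w) = tr (u ↦ R(u, v) w)` on the tangent
space at `x`. In abstract indices, `(∇_b ∇_a - ∇_a ∇_b) X^b = R_{ab} X^b`. -/
def ricci (x : M) : TangentSpace (𝓡 n) x →ₗ[ℝ] TangentSpace (𝓡 n) x →ₗ[ℝ] ℝ :=
  LinearMap.mk₂ ℝ
    (fun v w ↦ LinearMap.trace ℝ (TangentSpace (𝓡 n) x) (D.curvatureEnd v w))
    (fun v v' w ↦ by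
      rw [← map_add]; congr 1; ext1 u; exact map_add (D.curvature w u) v v')
    (fun c v w ↦ by
      rw [← map_smul]; congr 1; ext1 u; exact map_smul (D.curvature w u) c v)
    (fun v w w' ↦ by
      rw [← map_add]; congr 1; ext1 u
      change D.curvature (w + w') u v = D.curvature w u v + D.curvature w' u v
      rw [curvature_add]; rfl)
    (fun c v w ↦ by
      rw [← map_smul]; congr 1; ext1 u
      change D.curvature (c • w) u v = c • D.curvature w u v
      rw [curvature_smul]; rfl)

/-- The projective Schouten tensor `P_{ab}` in dimension `n ≥ 2`: the solution of
`R_{ab} = (n - 1) P_{ab} - β_{ab}`, `β_{ab} = P_{ba} - P_{ab}` (see `schouten_unique`), which is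
`P_{ab} = (n R_{ab} + R_{ba}) / (n² - 1)`. -/
def schouten (x : M) : TangentSpace (𝓡 n) x →ₗ[ℝ] TangentSpace (𝓡 n) x →ₗ[ℝ] ℝ :=
  ((n : ℝ) ^ 2 - 1)⁻¹ • ((n : ℝ) • D.ricci x + (D.ricci x).flip)

theorem schouten_unique (hn : 2 ≤ n) (x : M)
    (P : TangentSpace (𝓡 n) x →ₗ[ℝ] TangentSpace (𝓡 n) x →ₗ[ℝ] ℝ) :
    P = D.schouten x ↔
      ∀ u v, D.ricci x u v = ((n : ℝ) - 1) * P u v - (P v u - P u v) := by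
  have h2 : (2 : ℝ) ≤ n := by exact_mod_cast hn
  have h3 : ((n : ℝ) ^ 2 - 1) ≠ 0 := by nlinarith
  constructor
  · rintro rfl u v
    simp only [schouten, LinearMap.smul_apply, LinearMap.add_apply, LinearMap.flip_apply,
      smul_eq_mul]
    field_simp
    ring
  · intro h
    ext u v
    simp only [schouten, LinearMap.smul_apply, LinearMap.add_apply, LinearMap.flip_apply,
      smul_eq_mul]
    rw [h u v, h v u]
    field_simp
    ring

/-- The skew part `β_{ab} = P_{ba} - P_{ab}` of the projective Schouten tensor, as a `2`-form:
`β(u, v) = P(v, u) - P(u, v)`. -/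
def beta : FormField n M 2 := fun x ↦
  { toFun := fun w ↦ D.schouten x (w 1) (w 0) - D.schouten x (w 0) (w 1)
    map_update_add' := by
      intro _ w i a b
      fin_cases i <;> simp <;> ring
    map_update_smul' := by
      intro _ w i c a
      fin_cases i <;> simp <;> ring
    map_eq_zero_of_eq' := by
      intro w i j hw hij
      have : w 0 = w 1 := by
        fin_cases i <;> fin_cases j <;> simp_all
      simp [this]
    cont := by
      let B : EuclideanSpace ℝ (Fin n) →ₗ[ℝ] EuclideanSpace ℝ (Fin n) →ₗ[ℝ] ℝ := D.schouten x
      have h : Continuous fun p : TangentSpace (𝓡 n) x × TangentSpace (𝓡 n) x ↦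
          D.schouten x p.1 p.2 := B.toContinuousBilinearMap.continuous₂
      have h1 : Continuous fun w : Fin 2 → TangentSpace (𝓡 n) x ↦
          D.schouten x (w 1) (w 0) :=
        h.comp (f := fun w : Fin 2 → TangentSpace (𝓡 n) x ↦ (w 1, w 0))
          ((continuous_apply 1).prodMk (continuous_apply 0))
      have h2 : Continuous fun w : Fin 2 → TangentSpace (𝓡 n) x ↦
          D.schouten x (w 0) (w 1) :=
        h.comp (f := fun w : Fin 2 → TangentSpace (𝓡 n) x ↦ (w 0, w 1))
          ((continuous_apply 0).prodMk (continuous_apply 1))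
      exact h1.sub h2 }

end TorsionFreeConnection

/-! ### Projective equivalence and metric connections -/

namespace TorsionFreeConnection

/-- The velocity `γ'(t)` of a curve. -/
def velocity (γ : ℝ → M) (t : ℝ) : TangentSpace (𝓡 n) (γ t) :=
  mfderiv 𝓘(ℝ, ℝ) (𝓡 n) γ t (1 : ℝ)

/-- The second derivative at time `t` of the coordinate expression of `γ` in the chart centred at
`γ t`. -/
def coordAcceleration (γ : ℝ → M) (t : ℝ) : EuclideanSpace ℝ (Fin n) :=
  iteratedDeriv 2 (fun s ↦ extChartAt (𝓡 n) (γ t) (γ s)) t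

/-- The acceleration `∇_{γ'} γ'` of a curve at time `t`: in the coordinates of the chart centred at
`γ t` it is `γ'' + Γ(γ', γ')`, where `Γ(v, v) = ∇_v V` for the field `V` with constant components
`v`. (Mathlib identifies the tangent space at `γ t` with the model space through this chart.) -/
def acceleration (D : TorsionFreeConnection n M) (γ : ℝ → M) (t : ℝ) :
    TangentSpace (𝓡 n) (γ t) :=
  (show TangentSpace (𝓡 n) (γ t) from coordAcceleration γ t) +
    D.cov (coordField (velocity γ t)) (γ t) (velocity γ t)

/-- The restriction of `γ` to the open interval `J` is an (affinely parametrised) geodesic. -/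
def IsGeodesicOn (D : TorsionFreeConnection n M) (γ : ℝ → M) (J : Set ℝ) : Prop :=
  ContMDiffOn 𝓘(ℝ, ℝ) (𝓡 n) ∞ γ J ∧ ∀ t ∈ J, D.acceleration γ t = 0

/-- Every geodesic of `D` becomes a geodesic of `D'` after a smooth regular reparametrisation. -/
def GeodesicsReparametriseTo (D D' : TorsionFreeConnection n M) : Prop :=
  ∀ (γ : ℝ → M) (J : Set ℝ), IsOpen J → J.OrdConnected → D.IsGeodesicOn γ J →
    ∃ (s : ℝ → ℝ) (J' : Set ℝ), IsOpen J' ∧ J'.OrdConnected ∧ ContDiffOn ℝ ∞ s J' ∧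
      (∀ t ∈ J', deriv s t ≠ 0) ∧ s '' J' = J ∧ D'.IsGeodesicOn (γ ∘ s) J'

/-- Projective equivalence: the two connections have the same geodesics as unparametrised
curves. -/
def ProjectivelyEquivalent (D D' : TorsionFreeConnection n M) : Prop :=
  D.GeodesicsReparametriseTo D' ∧ D'.GeodesicsReparametriseTo D

/-- The relation `∇'_a X^b = ∇_a X^b + Υ_a X^b + δ_a^b Υ_c X^c`. -/
def IsProjectiveChange (D D' : TorsionFreeConnection n M) (Υ : FormField n M 1) : Prop :=
  ∀ (X : (x : M) → TangentSpace (𝓡 n) x) (x : M), DifferentiableFieldAt X x →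
    ∀ u : TangentSpace (𝓡 n) x,
      D'.cov X x u = D.cov X x u + Υ x ![u] • X x + Υ x ![X x] • u

/-- `D` is the Levi-Civita connection of the Riemannian metric `g`: it is torsion-free and
`∇g = 0`. -/
def IsLeviCivita (D : TorsionFreeConnection n M)
    (g : ContMDiffRiemannianMetric (𝓡 n) ∞ (EuclideanSpace ℝ (Fin n))
      (TangentSpace (𝓡 n) : M → Type _)) : Prop :=
  ∀ (X Y : (x : M) → TangentSpace (𝓡 n) x) (x : M),
    DifferentiableFieldAt X x → DifferentiableFieldAt Y x →
    ∀ u : TangentSpace (𝓡 n) x,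
      mvfderiv (𝓡 n) (fun y ↦ g.inner y (X y) (Y y)) x u =
        g.inner x (D.cov X x u) (Y x) + g.inner x (X x) (D.cov Y x u)

/-- `D` is a metric connection: the Levi-Civita connection of some smooth Riemannian metric. -/
def IsMetric (D : TorsionFreeConnection n M) : Prop :=
  ∃ g : ContMDiffRiemannianMetric (𝓡 n) ∞ (EuclideanSpace ℝ (Fin n))
    (TangentSpace (𝓡 n) : M → Type _), D.IsLeviCivita g

end TorsionFreeConnection

end Connections

end

noncomputable section

/-! ### Vector fields in a chart -/

/-! Everything rests on a local potential for `β`. In a chart let `Γ` be the Christoffel symbols and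
`θ_a = Γ_{ac}^c / (n + 1)`, which is `chartPotential`. Since the connection is torsion-free, the
skew part of the Ricci tensor is a curl of the trace of `Γ`: the quadratic terms enter only through
a commutator, whose trace is zero (`ricci_sub_ricci_swap`). Hence `β = dθ` on the chart
(`formInChart_beta`), so `β` is smooth and `d² = 0` makes it closed. The `θ` of different charts do
not glue to a global form in general, so this alone does not make `β` exact.

Under a projective change, `Γ` gains `Υ_a δ_c^b + δ_a^b Υ_c`, so its trace gains `(n + 1) Υ` and `Υ
= θ' - θ` in every chart (`IsProjectiveChange.formInChart_eq`). The difference of the potentials is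
thus global; this gives both the smoothness of `Υ` and `β' = β + dΥ`.

Projective equivalence yields such an `Υ` as follows. Through every tangent vector `v` there is a
geodesic (`exists_isGeodesicOn`). The other connection makes it a geodesic only after
reparametrisation, so its acceleration there is tangent to the curve, and the difference tensor `A`
satisfies `A(v, v) ∝ v`. As `A` is symmetric, linear algebra gives `A(v, w) = Υ(v) w + Υ(w) v`
(`exists_linearForm_of_forall_apply_self`).

For a Levi-Civita connection the curvature endomorphisms are skew for the metric, hence traceless;
their trace is, up to a constant factor, the curl of `θ`. So `β` vanishes identically
(`IsMetric.beta_eq_zero`), and the class of `β` is zero for every connection projectively equivalent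
to it. -/

/-- A constant vector field on a normed space. -/
def constField {F : Type*} [NormedAddCommGroup F] [NormedSpace ℝ F] (w : F) :
    (x : F) → TangentSpace 𝓘(ℝ, F) x := fun _ ↦ w

theorem contMDiff_constField {F : Type*} [NormedAddCommGroup F] [NormedSpace ℝ F] (w : F) :
    ContMDiff 𝓘(ℝ, F) (𝓘(ℝ, F).prod 𝓘(ℝ, F)) ∞
      (fun z : F ↦ TotalSpace.mk' F z (constField w z)) := fun _ ↦
  contMDiffAt_vectorSpace_iff_contDiffAt.2 (contDiffAt_const (c := w))

theorem mlieBracket_constField {F : Type*} [NormedAddCommGroup F] [NormedSpace ℝ F]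
    (u v : F) : mlieBracket 𝓘(ℝ, F) (constField u) (constField v) = 0 := by
  rw [← mlieBracketWithin_univ, mlieBracketWithin_eq_lieBracketWithin]
  funext y
  change fderivWithin ℝ (fun _ ↦ v) univ y u - fderivWithin ℝ (fun _ ↦ u) univ y v = 0
  simp

section ChartFields

variable {n : ℕ} {M : Type*} [TopologicalSpace M] [ChartedSpace (EuclideanSpace ℝ (Fin n)) M]

/-- The derivative at `y` of the inverse of the chart centred at `x₀`. -/
def chartPush (x₀ : M) (y : EuclideanSpace ℝ (Fin n)) :
    EuclideanSpace ℝ (Fin n) →L[ℝ] TangentSpace (𝓡 n) ((extChartAt (𝓡 n) x₀).symm y) :=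
  mfderiv 𝓘(ℝ, EuclideanSpace ℝ (Fin n)) (𝓡 n) (extChartAt (𝓡 n) x₀).symm y

/-- The derivative at `p` of the chart centred at `x₀`. -/
def chartPull (x₀ p : M) : TangentSpace (𝓡 n) p →L[ℝ] EuclideanSpace ℝ (Fin n) :=
  mfderiv (𝓡 n) 𝓘(ℝ, EuclideanSpace ℝ (Fin n)) (extChartAt (𝓡 n) x₀) p

/-- The coordinate expression of the vector field `Z` in the chart centred at `x₀`. -/
def chartRep (x₀ : M) (Z : (x : M) → TangentSpace (𝓡 n) x) (y : EuclideanSpace ℝ (Fin n)) :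
    EuclideanSpace ℝ (Fin n) :=
  chartPull x₀ ((extChartAt (𝓡 n) x₀).symm y) (Z ((extChartAt (𝓡 n) x₀).symm y))

/-- The vector field with constant components `w` in the chart centred at `x₀`. -/
def chartFrame (x₀ : M) (w : EuclideanSpace ℝ (Fin n)) : (x : M) → TangentSpace (𝓡 n) x :=
  mpullback (𝓡 n) 𝓘(ℝ, EuclideanSpace ℝ (Fin n)) (extChartAt (𝓡 n) x₀) (constField w)

theorem chartRep_add (x₀ : M) (Z Z' : (x : M) → TangentSpace (𝓡 n) x) :
    chartRep x₀ (Z + Z') = chartRep x₀ Z + chartRep x₀ Z' := by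
  funext y
  exact map_add (chartPull x₀ _) _ _

theorem chartRep_smul (x₀ : M) (g : M → ℝ) (Z : (x : M) → TangentSpace (𝓡 n) x) :
    chartRep x₀ (g • Z) = fun y ↦ g ((extChartAt (𝓡 n) x₀).symm y) • chartRep x₀ Z y := by
  funext y
  exact map_smul (chartPull x₀ _) _ _

variable [IsManifold (𝓡 n) ∞ M]

instance : IsManifold (𝓡 n) 1 M := IsManifold.of_le (n := ∞) (by simp)

theorem chartPull_chartPush (x₀ : M) {y : EuclideanSpace ℝ (Fin n)}
    (hy : y ∈ (extChartAt (𝓡 n) x₀).target) (w : EuclideanSpace ℝ (Fin n)) :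
    chartPull x₀ ((extChartAt (𝓡 n) x₀).symm y) (chartPush x₀ y w) = w := by
  have h := mfderiv_extChartAt_comp_mfderivWithin_extChartAt_symm (I := 𝓡 n) hy
  rw [(𝓡 n).range_eq_univ, mfderivWithin_univ] at h
  exact congr($h w)

theorem chartPush_chartPull (x₀ : M) {y : EuclideanSpace ℝ (Fin n)}
    (hy : y ∈ (extChartAt (𝓡 n) x₀).target)
    (u : TangentSpace (𝓡 n) ((extChartAt (𝓡 n) x₀).symm y)) :
    chartPush x₀ y (chartPull x₀ ((extChartAt (𝓡 n) x₀).symm y) u) = u := by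
  have h := mfderivWithin_extChartAt_symm_comp_mfderiv_extChartAt (I := 𝓡 n) hy
  rw [(𝓡 n).range_eq_univ, mfderivWithin_univ] at h
  exact congr($h u)

/-- The tangent space at `x` is by construction the model space read through the preferred chart at
`x`, so the derivative of that chart at its own centre is the identity. -/
theorem chartPull_self (x : M) (u : TangentSpace (𝓡 n) x) : chartPull x x u = u := by
  have h := mfderiv_extChartAt_self (I := 𝓡 n) (x := x)
  exact congr($h u)

theorem chartPull_chartFrame (x₀ : M) {p : M} (hp : p ∈ (extChartAt (𝓡 n) x₀).source)
    (w : EuclideanSpace ℝ (Fin n)) : chartPull x₀ p (chartFrame x₀ w p) = w := by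
  have h := isInvertible_mfderiv_extChartAt (I := 𝓡 n) hp
  exact h.self_apply_inverse w

theorem chartFrame_apply_symm (x₀ : M) {y : EuclideanSpace ℝ (Fin n)}
    (hy : y ∈ (extChartAt (𝓡 n) x₀).target) (w : EuclideanSpace ℝ (Fin n)) :
    chartFrame x₀ w ((extChartAt (𝓡 n) x₀).symm y) = chartPush x₀ y w := by
  have h := chartPull_chartFrame x₀ ((extChartAt (𝓡 n) x₀).map_target hy) w
  rw [← chartPush_chartPull x₀ hy (chartFrame x₀ w _), h]

theorem chartRep_chartFrame (x₀ : M) {y : EuclideanSpace ℝ (Fin n)}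
    (hy : y ∈ (extChartAt (𝓡 n) x₀).target) (w : EuclideanSpace ℝ (Fin n)) :
    chartRep x₀ (chartFrame x₀ w) y = w :=
  chartPull_chartFrame x₀ ((extChartAt (𝓡 n) x₀).map_target hy) w

theorem chartRep_chartFrame_eventuallyEq (x₀ : M) {y : EuclideanSpace ℝ (Fin n)}
    (hy : y ∈ (extChartAt (𝓡 n) x₀).target) (w : EuclideanSpace ℝ (Fin n)) :
    chartRep x₀ (chartFrame x₀ w) =ᶠ[𝓝 y] fun _ ↦ w := by
  filter_upwards [(isOpen_extChartAt_target x₀).mem_nhds hy] with z hz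
  exact chartRep_chartFrame x₀ hz w

theorem contMDiffAt_chartFrame (x₀ : M) {p : M} (hp : p ∈ (extChartAt (𝓡 n) x₀).source)
    (w : EuclideanSpace ℝ (Fin n)) :
    ContMDiffAt (𝓡 n) ((𝓡 n).prod 𝓘(ℝ, EuclideanSpace ℝ (Fin n))) ∞
      (fun y ↦ TotalSpace.mk' (EuclideanSpace ℝ (Fin n)) y (chartFrame x₀ w y)) p := by
  refine ContMDiffAt.mpullback_vectorField_preimage (n := ∞) (m := ∞) ?_
    (contMDiffAt_extChartAt' (by simpa using hp)) (isInvertible_mfderiv_extChartAt hp) (by simp)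
  exact (contMDiff_constField w).contMDiffAt

theorem smoothFieldOn_chartFrame (x₀ : M) (w : EuclideanSpace ℝ (Fin n)) :
    SmoothFieldOn (chartFrame x₀ w) (extChartAt (𝓡 n) x₀).source :=
  fun _ hp ↦ (contMDiffAt_chartFrame x₀ hp w).contMDiffWithinAt

theorem differentiableFieldAt_chartFrame (x₀ : M) {p : M}
    (hp : p ∈ (extChartAt (𝓡 n) x₀).source) (w : EuclideanSpace ℝ (Fin n)) :
    DifferentiableFieldAt (chartFrame x₀ w) p :=
  (contMDiffAt_chartFrame x₀ hp w).mdifferentiableAt (by simp)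

/-- Lie brackets commute with pullback by the chart, and constant fields commute. This removes the
bracket term from the torsion and the curvature of coordinate fields. -/
theorem mlieBracket_chartFrame (x₀ : M) {p : M} (hp : p ∈ (extChartAt (𝓡 n) x₀).source)
    (u v : EuclideanSpace ℝ (Fin n)) :
    mlieBracket (𝓡 n) (chartFrame x₀ u) (chartFrame x₀ v) p = 0 := by
  have hc := fun w : EuclideanSpace ℝ (Fin n) ↦
    (contMDiff_constField w).contMDiffAt (x := extChartAt (𝓡 n) x₀ p) |>.mdifferentiableAt
      (by simp)
  have h2 : minSmoothness ℝ 2 ≤ (∞ : ℕ∞ω) := by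
    rw [minSmoothness_of_isRCLikeNormedField]
    exact WithTop.coe_le_coe.2 le_top
  have : IsManifold (𝓡 n) (minSmoothness ℝ 2) M := IsManifold.of_le h2
  have h := mpullback_mlieBracket (I := 𝓡 n) (f := extChartAt (𝓡 n) x₀) (n := ∞)
    (hc u) (hc v) (contMDiffAt_extChartAt' (by simpa using hp)) h2
  unfold chartFrame
  rw [← h, mpullback_apply, mlieBracket_constField]
  exact map_zero _

/-- Regularity of a section is tested in the bundle trivialisation; this turns it into regularity of
`chartRep`. -/
theorem chartPull_eq_trivializationAt (x₀ : M) {p : M}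
    (hp : p ∈ (extChartAt (𝓡 n) x₀).source) (u : TangentSpace (𝓡 n) p) :
    chartPull x₀ p u = (trivializationAt (EuclideanSpace ℝ (Fin n))
      (TangentSpace (𝓡 n) : M → Type _) x₀ ⟨p, u⟩).2 := by
  rw [extChartAt_source] at hp
  have h := TangentBundle.continuousLinearMapAt_trivializationAt (I := 𝓡 n) hp
  have h2 := congr($h u)
  rw [Trivialization.continuousLinearMapAt_apply, Trivialization.coe_linearMapAt_of_mem] at h2
  · exact h2.symm
  · simpa using hp

theorem contMDiffAt_symm_extChartAt (x₀ : M) {y : EuclideanSpace ℝ (Fin n)}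
    (hy : y ∈ (extChartAt (𝓡 n) x₀).target) :
    ContMDiffAt 𝓘(ℝ, EuclideanSpace ℝ (Fin n)) (𝓡 n) ∞ (extChartAt (𝓡 n) x₀).symm y :=
  (contMDiffOn_extChartAt_symm x₀).contMDiffAt ((isOpen_extChartAt_target x₀).mem_nhds hy)

theorem contDiffAt_chartRep (x₀ : M) {y : EuclideanSpace ℝ (Fin n)}
    (hy : y ∈ (extChartAt (𝓡 n) x₀).target) {Z : (x : M) → TangentSpace (𝓡 n) x}
    (hZ : ContMDiffAt (𝓡 n) ((𝓡 n).prod 𝓘(ℝ, EuclideanSpace ℝ (Fin n))) ∞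
      (fun y ↦ TotalSpace.mk' (EuclideanSpace ℝ (Fin n)) y (Z y))
      ((extChartAt (𝓡 n) x₀).symm y)) :
    ContDiffAt ℝ ∞ (chartRep x₀ Z) y := by
  have hp := (extChartAt (𝓡 n) x₀).map_target hy
  rw [(trivializationAt (EuclideanSpace ℝ (Fin n))
    (TangentSpace (𝓡 n) : M → Type _) x₀).contMDiffAt_section_iff
    (by simpa using hp)] at hZ
  rw [← contMDiffAt_iff_contDiffAt]
  refine (hZ.comp y (contMDiffAt_symm_extChartAt x₀ hy)).congr_of_eventuallyEq ?_
  filter_upwards [(isOpen_extChartAt_target x₀).mem_nhds hy] with z hz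
  exact chartPull_eq_trivializationAt x₀ ((extChartAt (𝓡 n) x₀).map_target hz) _

theorem differentiableAt_chartRep (x₀ : M) {y : EuclideanSpace ℝ (Fin n)}
    (hy : y ∈ (extChartAt (𝓡 n) x₀).target) {Z : (x : M) → TangentSpace (𝓡 n) x}
    (hZ : DifferentiableFieldAt Z ((extChartAt (𝓡 n) x₀).symm y)) :
    DifferentiableAt ℝ (chartRep x₀ Z) y := by
  have hp := (extChartAt (𝓡 n) x₀).map_target hy
  rw [DifferentiableFieldAt, (trivializationAt (EuclideanSpace ℝ (Fin n))
    (TangentSpace (𝓡 n) : M → Type _) x₀).mdifferentiableAt_section_iff _ _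
    (by simpa using hp)] at hZ
  rw [← mdifferentiableAt_iff_differentiableAt]
  refine (hZ.comp y ((contMDiffAt_symm_extChartAt x₀ hy).mdifferentiableAt
    (by simp))).congr_of_eventuallyEq ?_
  filter_upwards [(isOpen_extChartAt_target x₀).mem_nhds hy] with z hz
  exact chartPull_eq_trivializationAt x₀ ((extChartAt (𝓡 n) x₀).map_target hz) _

/-- The derivative of a function on `M` in the chart centred at `x₀`. -/
theorem fderiv_comp_extChartAt_symm (x₀ : M) {y : EuclideanSpace ℝ (Fin n)}
    (hy : y ∈ (extChartAt (𝓡 n) x₀).target) {g : M → ℝ}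
    (hg : MDifferentiableAt (𝓡 n) 𝓘(ℝ, ℝ) g ((extChartAt (𝓡 n) x₀).symm y))
    (u : EuclideanSpace ℝ (Fin n)) :
    DifferentiableAt ℝ (fun z ↦ g ((extChartAt (𝓡 n) x₀).symm z)) y ∧
    fderiv ℝ (fun z ↦ g ((extChartAt (𝓡 n) x₀).symm z)) y u =
      mvfderiv (𝓡 n) g ((extChartAt (𝓡 n) x₀).symm y) (chartPush x₀ y u) := by
  have hs := (contMDiffAt_symm_extChartAt x₀ hy).mdifferentiableAt (by simp)
  have h := mfderiv_comp y hg hs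
  have h1 := hg.comp y hs
  rw [mdifferentiableAt_iff_differentiableAt] at h1
  refine ⟨h1, ?_⟩
  rw [mfderiv_eq_fderiv] at h
  exact congr($h u)

end ChartFields

/-! ### Christoffel symbols -/

section Christoffel

variable {n : ℕ} {M : Type*} [TopologicalSpace M] [ChartedSpace (EuclideanSpace ℝ (Fin n)) M]
  [IsManifold (𝓡 n) ∞ M]

/-- The flat covariant derivative of the chart centred at `x₀`. -/
def chartFlat (x₀ : M) (Z : (x : M) → TangentSpace (𝓡 n) x) (p : M) :
    TangentSpace (𝓡 n) p →L[ℝ] TangentSpace (𝓡 n) p :=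
  (chartPull x₀ p).inverse ∘L
    (fderiv ℝ (chartRep x₀ Z) (extChartAt (𝓡 n) x₀ p) ∘L chartPull x₀ p)

theorem inverse_chartPull_apply (x₀ : M) {p : M} (hp : p ∈ (extChartAt (𝓡 n) x₀).source)
    (u : TangentSpace (𝓡 n) p) : (chartPull x₀ p).inverse (chartPull x₀ p u) = u :=
  (isInvertible_mfderiv_extChartAt (I := 𝓡 n) hp).inverse_apply_self u

theorem chartPull_inverse_apply (x₀ : M) {p : M} (hp : p ∈ (extChartAt (𝓡 n) x₀).source)
    (u : EuclideanSpace ℝ (Fin n)) : chartPull x₀ p ((chartPull x₀ p).inverse u) = u :=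
  (isInvertible_mfderiv_extChartAt (I := 𝓡 n) hp).self_apply_inverse u

theorem differentiableAt_chartRep_extChartAt (x₀ : M) {p : M}
    (hp : p ∈ (extChartAt (𝓡 n) x₀).source) {Z : (x : M) → TangentSpace (𝓡 n) x}
    (hZ : DifferentiableFieldAt Z p) :
    DifferentiableAt ℝ (chartRep x₀ Z) (extChartAt (𝓡 n) x₀ p) := by
  refine differentiableAt_chartRep x₀ ((extChartAt (𝓡 n) x₀).map_source hp) ?_
  rwa [(extChartAt (𝓡 n) x₀).left_inv hp]

/-- Two covariant derivatives differ by a tensor, so once the flat one is known to be a covariant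
derivative on the chart domain, the Christoffel symbols are obtained as a bilinear map without
choosing indices. -/
theorem isCovariantDerivativeOn_chartFlat (x₀ : M) :
    IsCovariantDerivativeOn (I := 𝓡 n) (EuclideanSpace ℝ (Fin n))
      (chartFlat x₀) (extChartAt (𝓡 n) x₀).source where
  add {Z Z' p} hZ hZ' hp := by
    have h1 := differentiableAt_chartRep_extChartAt x₀ hp hZ
    have h2 := differentiableAt_chartRep_extChartAt x₀ hp hZ'
    ext1 u
    simp only [chartFlat, chartRep_add, fderiv_add h1 h2, ContinuousLinearMap.comp_apply,
      add_apply, map_add]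
  leibniz {Z g p} hZ hg hp := by
    have h1 := differentiableAt_chartRep_extChartAt x₀ hp hZ
    have hy := (extChartAt (𝓡 n) x₀).map_source hp
    have hg' : MDifferentiableAt (𝓡 n) 𝓘(ℝ, ℝ) g
        ((extChartAt (𝓡 n) x₀).symm (extChartAt (𝓡 n) x₀ p)) := by
      rwa [(extChartAt (𝓡 n) x₀).left_inv hp]
    ext1 u
    have h2 := fun w ↦ fderiv_comp_extChartAt_symm x₀ hy hg' w
    have h3 : mvfderiv (𝓡 n) g ((extChartAt (𝓡 n) x₀).symm (extChartAt (𝓡 n) x₀ p))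
        (chartPush x₀ (extChartAt (𝓡 n) x₀ p) (chartPull x₀ p u)) = mvfderiv (𝓡 n) g p u := by
      -- The points `(extChartAt (𝓡 n) x₀).symm (extChartAt (𝓡 n) x₀ p)` and `p` are equal but not
      -- definitionally, so vectors over them lie in different types. They are compared through
      -- `chartPull`, with the point generalised to `q` before substituting. The same device recurs
      -- below.
      have key : ∀ q (hq : q = p) (w : TangentSpace (𝓡 n) q),
          chartPull x₀ q w = chartPull x₀ p u → mvfderiv (𝓡 n) g q w = mvfderiv (𝓡 n) g p u := by
        rintro q rfl w hw
        rw [← inverse_chartPull_apply x₀ hp w, hw, inverse_chartPull_apply x₀ hp]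
      exact key _ ((extChartAt (𝓡 n) x₀).left_inv hp) _ (chartPull_chartPush x₀ hy _)
    have h4 : chartRep x₀ Z (extChartAt (𝓡 n) x₀ p) = chartPull x₀ p (Z p) := by
      have key : ∀ q, q = p → chartPull x₀ q (Z q) = chartPull x₀ p (Z p) := by
        rintro q rfl
        rfl
      exact key _ ((extChartAt (𝓡 n) x₀).left_inv hp)
    have h5 : g ((extChartAt (𝓡 n) x₀).symm (extChartAt (𝓡 n) x₀ p)) = g p := by
      rw [(extChartAt (𝓡 n) x₀).left_inv hp]
    have h6 : fderiv ℝ (chartRep x₀ (g • Z)) (extChartAt (𝓡 n) x₀ p) (chartPull x₀ p u) =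
        g p • fderiv ℝ (chartRep x₀ Z) (extChartAt (𝓡 n) x₀ p) (chartPull x₀ p u) +
          mvfderiv (𝓡 n) g p u • chartPull x₀ p (Z p) := by
      rw [chartRep_smul, fderiv_fun_smul (h2 0).1 h1]
      simp only [add_apply, smul_apply, ContinuousLinearMap.smulRight_apply]
      rw [(h2 _).2, h3, h4, h5]
    change (chartPull x₀ p).inverse (fderiv ℝ (chartRep x₀ (g • Z)) _ (chartPull x₀ p u)) =
      g p • (chartPull x₀ p).inverse (fderiv ℝ (chartRep x₀ Z) _ (chartPull x₀ p u)) +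
        mvfderiv (𝓡 n) g p u • Z p
    rw [h6, map_add, map_smul, map_smul, inverse_chartPull_apply x₀ hp]

namespace TorsionFreeConnection

variable (D : TorsionFreeConnection n M)

/-- The difference of a connection and the flat connection of a chart. -/
def chartDifference (x₀ p : M) :
    TangentSpace (𝓡 n) p →L[ℝ] TangentSpace (𝓡 n) p →L[ℝ] TangentSpace (𝓡 n) p :=
  (D.cov.isCovariantDerivativeOn (s := (extChartAt (𝓡 n) x₀).source)).difference
    (isCovariantDerivativeOn_chartFlat x₀) p

theorem chartDifference_apply (x₀ : M) {p : M} (hp : p ∈ (extChartAt (𝓡 n) x₀).source)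
    {Z : (x : M) → TangentSpace (𝓡 n) x} (hZ : DifferentiableFieldAt Z p) :
    D.chartDifference x₀ p (Z p) = D.cov Z p - chartFlat x₀ Z p :=
  IsCovariantDerivativeOn.difference_apply _ _ hp hZ

/-- The Christoffel symbols of a connection in the chart centred at `x₀`: `christoffel x₀ y w u` is
the derivative in the direction `u` of the field with constant components `w`. -/
def christoffel (x₀ : M) (y : EuclideanSpace ℝ (Fin n)) :
    EuclideanSpace ℝ (Fin n) →L[ℝ] EuclideanSpace ℝ (Fin n) →L[ℝ] EuclideanSpace ℝ (Fin n) :=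
  LinearMap.toContinuousBilinearMap (LinearMap.mk₂ ℝ
    (fun w u ↦ chartPull x₀ _ (D.chartDifference x₀ ((extChartAt (𝓡 n) x₀).symm y)
      (chartPush x₀ y w) (chartPush x₀ y u)))
    (fun w w' u ↦ by simp only [map_add, add_apply])
    (fun c w u ↦ by simp only [map_smul, smul_apply])
    (fun w u u' ↦ by simp only [map_add])
    (fun c w u ↦ by simp only [map_smul]))

theorem christoffel_apply (x₀ : M) (y w u : EuclideanSpace ℝ (Fin n)) :
    D.christoffel x₀ y w u = chartPull x₀ _
      (D.chartDifference x₀ ((extChartAt (𝓡 n) x₀).symm y)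
        (chartPush x₀ y w) (chartPush x₀ y u)) := rfl

/-- The covariant derivative in a chart. -/
theorem chartPull_cov (x₀ : M) {y : EuclideanSpace ℝ (Fin n)}
    (hy : y ∈ (extChartAt (𝓡 n) x₀).target) {Z : (x : M) → TangentSpace (𝓡 n) x}
    (hZ : DifferentiableFieldAt Z ((extChartAt (𝓡 n) x₀).symm y))
    (u : EuclideanSpace ℝ (Fin n)) :
    chartPull x₀ _ (D.cov Z ((extChartAt (𝓡 n) x₀).symm y) (chartPush x₀ y u)) =
      fderiv ℝ (chartRep x₀ Z) y u + D.christoffel x₀ y (chartRep x₀ Z y) u := by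
  have hp := (extChartAt (𝓡 n) x₀).map_target hy
  rw [christoffel_apply, chartRep, chartPush_chartPull x₀ hy, chartDifference_apply D x₀ hp hZ]
  simp only [chartFlat, sub_apply, map_sub, ContinuousLinearMap.comp_apply]
  rw [chartPull_inverse_apply x₀ hp, chartPull_chartPush x₀ hy,
    (extChartAt (𝓡 n) x₀).right_inv hy]
  abel

theorem cov_eq (x₀ : M) {y : EuclideanSpace ℝ (Fin n)}
    (hy : y ∈ (extChartAt (𝓡 n) x₀).target) {Z : (x : M) → TangentSpace (𝓡 n) x}
    (hZ : DifferentiableFieldAt Z ((extChartAt (𝓡 n) x₀).symm y))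
    (u : EuclideanSpace ℝ (Fin n)) :
    D.cov Z ((extChartAt (𝓡 n) x₀).symm y) (chartPush x₀ y u) = chartPush x₀ y
      (fderiv ℝ (chartRep x₀ Z) y u + D.christoffel x₀ y (chartRep x₀ Z y) u) := by
  rw [← D.chartPull_cov x₀ hy hZ, chartPush_chartPull x₀ hy]

theorem chartPull_cov_chartFrame (x₀ : M) {y : EuclideanSpace ℝ (Fin n)}
    (hy : y ∈ (extChartAt (𝓡 n) x₀).target) (w u : EuclideanSpace ℝ (Fin n)) :
    chartPull x₀ _ (D.cov (chartFrame x₀ w) ((extChartAt (𝓡 n) x₀).symm y) (chartPush x₀ y u)) =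
      D.christoffel x₀ y w u := by
  have hp := (extChartAt (𝓡 n) x₀).map_target hy
  rw [D.chartPull_cov x₀ hy (differentiableFieldAt_chartFrame x₀ hp w),
    (chartRep_chartFrame_eventuallyEq x₀ hy w).fderiv_eq, chartRep_chartFrame x₀ hy]
  simp

/-- Vanishing torsion, evaluated on two commuting coordinate fields. -/
theorem christoffel_symm (x₀ : M) {y : EuclideanSpace ℝ (Fin n)}
    (hy : y ∈ (extChartAt (𝓡 n) x₀).target) (w u : EuclideanSpace ℝ (Fin n)) :
    D.christoffel x₀ y w u = D.christoffel x₀ y u w := by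
  have hp := (extChartAt (𝓡 n) x₀).map_target hy
  have h := CovariantDerivative.torsion_eq_zero_iff D.cov |>.1 D.torsion_eq_zero
    (differentiableFieldAt_chartFrame x₀ hp u) (differentiableFieldAt_chartFrame x₀ hp w)
  rw [mlieBracket_chartFrame x₀ hp, chartFrame_apply_symm x₀ hy, chartFrame_apply_symm x₀ hy,
    sub_eq_zero] at h
  rw [← D.chartPull_cov_chartFrame x₀ hy, ← D.chartPull_cov_chartFrame x₀ hy, h]

/-- In finite dimension it suffices to fix the two arguments; the resulting function is the
coordinate expression of the covariant derivative of one frame field along another, which is smooth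
because the connection is. -/
theorem contDiffOn_christoffel [T2Space M] (x₀ : M) :
    ContDiffOn ℝ ∞ (D.christoffel x₀) (extChartAt (𝓡 n) x₀).target := by
  rw [contDiffOn_clm_apply]
  intro w
  rw [contDiffOn_clm_apply]
  intro u y hy
  have hp := (extChartAt (𝓡 n) x₀).map_target hy
  have h1 := D.contMDiffAt_cov ((isOpen_extChartAt_source x₀).mem_nhds hp)
    (smoothFieldOn_chartFrame x₀ w)
  have h2 : ContMDiffAt (𝓡 n) ((𝓡 n).prod 𝓘(ℝ, EuclideanSpace ℝ (Fin n))) ∞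
      (fun q ↦ TotalSpace.mk' (EuclideanSpace ℝ (Fin n)) q
        (D.cov (chartFrame x₀ w) q (chartFrame x₀ u q))) ((extChartAt (𝓡 n) x₀).symm y) :=
    ContMDiffAt.clm_bundle_apply (b := fun q ↦ q) h1 (contMDiffAt_chartFrame x₀ hp u)
  refine (contDiffAt_chartRep x₀ hy h2).contDiffWithinAt.congr_of_mem ?_ hy
  intro z hz
  rw [← D.chartPull_cov_chartFrame x₀ hz, chartRep, chartFrame_apply_symm x₀ hz]

theorem contDiffAt_christoffel [T2Space M] (x₀ : M) {y : EuclideanSpace ℝ (Fin n)}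
    (hy : y ∈ (extChartAt (𝓡 n) x₀).target) : ContDiffAt ℝ ∞ (D.christoffel x₀) y :=
  (D.contDiffOn_christoffel x₀).contDiffAt ((isOpen_extChartAt_target x₀).mem_nhds hy)

theorem differentiableAt_christoffel [T2Space M] (x₀ : M) {y : EuclideanSpace ℝ (Fin n)}
    (hy : y ∈ (extChartAt (𝓡 n) x₀).target) : DifferentiableAt ℝ (D.christoffel x₀) y :=
  (D.contDiffAt_christoffel x₀ hy).differentiableAt (by simp)

end TorsionFreeConnection

end Christoffel

/-! ### The curvature and the form `β` in a chart -/

section ChartCurvature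

theorem minSmoothness_two_le_infty : minSmoothness ℝ 2 ≤ (∞ : ℕ∞ω) := by
  rw [minSmoothness_of_isRCLikeNormedField]
  exact WithTop.coe_le_coe.2 le_top

/-- The trace of endomorphisms of a finite-dimensional space, as a continuous linear map. -/
def traceCLM (E : Type*) [NormedAddCommGroup E] [NormedSpace ℝ E] [FiniteDimensional ℝ E] :
    (E →L[ℝ] E) →L[ℝ] ℝ :=
  LinearMap.toContinuousLinearMap (LinearMap.trace ℝ E ∘ₗ ContinuousLinearMap.coeLM ℝ)

theorem traceCLM_apply {E : Type*} [NormedAddCommGroup E] [NormedSpace ℝ E]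
    [FiniteDimensional ℝ E] (A : E →L[ℝ] E) :
    traceCLM E A = LinearMap.trace ℝ E (A : E →ₗ[ℝ] E) := rfl

theorem extDeriv_ofSubsingleton_apply {E : Type*} [NormedAddCommGroup E] [NormedSpace ℝ E]
    {φ : E → E →L[ℝ] ℝ} {y : E} (hφ : DifferentiableAt ℝ φ y) (m : Fin 2 → E) :
    extDeriv (fun z ↦ ContinuousAlternatingMap.ofSubsingleton ℝ E ℝ (0 : Fin 1) (φ z)) y m =
      fderiv ℝ φ y (m 0) (m 1) - fderiv ℝ φ y (m 1) (m 0) := by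
  have hd : DifferentiableAt ℝ
      (fun z ↦ ContinuousAlternatingMap.ofSubsingleton ℝ E ℝ (0 : Fin 1) (φ z)) y :=
    (ContinuousAlternatingMap.ofSubsingletonLIE (𝕜 := ℝ) (E := E) (F := ℝ) (0 : Fin 1)).differentiableAt.comp y hφ
  have h1 : ∀ w u : E, fderiv ℝ (fun z ↦ φ z w) y u = fderiv ℝ φ y u w := by
    intro w u
    rw [fderiv_clm_apply hφ (differentiableAt_const w)]
    simp
  rw [extDeriv_apply hd]
  simp [Fin.sum_univ_two, Fin.removeNth, h1, sub_eq_add_neg]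

variable {n : ℕ} {M : Type*} [TopologicalSpace M] [ChartedSpace (EuclideanSpace ℝ (Fin n)) M]
  [IsManifold (𝓡 n) ∞ M]

namespace TorsionFreeConnection

variable (D : TorsionFreeConnection n M)

theorem fderiv_christoffel_symm [T2Space M] (x₀ : M) {y : EuclideanSpace ℝ (Fin n)}
    (hy : y ∈ (extChartAt (𝓡 n) x₀).target) (s w u : EuclideanSpace ℝ (Fin n)) :
    fderiv ℝ (D.christoffel x₀) y s w u = fderiv ℝ (D.christoffel x₀) y s u w := by
  have hd := D.differentiableAt_christoffel x₀ hy
  have h1 : ∀ w u : EuclideanSpace ℝ (Fin n),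
      fderiv ℝ (fun z ↦ D.christoffel x₀ z w u) y s = fderiv ℝ (D.christoffel x₀) y s w u := by
    intro w u
    rw [fderiv_clm_apply (hd.clm_apply (differentiableAt_const w)) (differentiableAt_const u),
      fderiv_clm_apply hd (differentiableAt_const w)]
    simp
  rw [← h1, ← h1]
  refine congr($(Filter.EventuallyEq.fderiv_eq ?_) s)
  filter_upwards [(isOpen_extChartAt_target x₀).mem_nhds hy] with z hz
  exact D.christoffel_symm x₀ hz w u

/-- The form of the right side matters: the second derivative of `Z` is symmetric in `u`, `v`, and
so is the sum of the two terms containing its first derivative. All of them cancel in the curvature,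
which therefore depends only on the value of `Z` at the point. -/
theorem chartPull_cov_cov [T2Space M] (x₀ : M) {y : EuclideanSpace ℝ (Fin n)}
    (hy : y ∈ (extChartAt (𝓡 n) x₀).target) {Z : (x : M) → TangentSpace (𝓡 n) x} {s : Set M}
    (hs : s ∈ 𝓝 ((extChartAt (𝓡 n) x₀).symm y)) (hZ : SmoothFieldOn Z s)
    (u v : EuclideanSpace ℝ (Fin n)) :
    chartPull x₀ _ (D.cov (fun q ↦ D.cov Z q (chartFrame x₀ v q))
        ((extChartAt (𝓡 n) x₀).symm y) (chartPush x₀ y u)) =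
      fderiv ℝ (fderiv ℝ (chartRep x₀ Z)) y u v +
        fderiv ℝ (D.christoffel x₀) y u (chartRep x₀ Z y) v +
        D.christoffel x₀ y (fderiv ℝ (chartRep x₀ Z) y u) v +
        D.christoffel x₀ y (fderiv ℝ (chartRep x₀ Z) y v) u +
        D.christoffel x₀ y (D.christoffel x₀ y (chartRep x₀ Z y) v) u := by
  have hp := (extChartAt (𝓡 n) x₀).map_target hy
  have hK := D.mdifferentiableAt_cov_apply hs hZ (differentiableFieldAt_chartFrame x₀ hp v)
  have hrep : ∀ z ∈ (extChartAt (𝓡 n) x₀).target,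
      DifferentiableFieldAt Z ((extChartAt (𝓡 n) x₀).symm z) →
      chartRep x₀ (fun q ↦ D.cov Z q (chartFrame x₀ v q)) z =
        fderiv ℝ (chartRep x₀ Z) z v + D.christoffel x₀ z (chartRep x₀ Z z) v := by
    intro z hz hZz
    rw [← D.chartPull_cov x₀ hz hZz, chartRep, chartFrame_apply_symm x₀ hz]
  have hev : chartRep x₀ (fun q ↦ D.cov Z q (chartFrame x₀ v q)) =ᶠ[𝓝 y] fun z ↦
      fderiv ℝ (chartRep x₀ Z) z v + D.christoffel x₀ z (chartRep x₀ Z z) v := by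
    have hc := (continuousAt_extChartAt_symm'' (I := 𝓡 n) hy).preimage_mem_nhds
      (interior_mem_nhds.2 hs)
    filter_upwards [(isOpen_extChartAt_target x₀).mem_nhds hy, hc] with z hz hzs
    exact hrep z hz ((hZ.contMDiffAt (mem_interior_iff_mem_nhds.1 hzs)).mdifferentiableAt (by simp))
  have hZr := contDiffAt_chartRep x₀ hy (hZ.contMDiffAt hs)
  have hZd : DifferentiableAt ℝ (chartRep x₀ Z) y := hZr.differentiableAt (by simp)
  have hZd2 : DifferentiableAt ℝ (fderiv ℝ (chartRep x₀ Z)) y :=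
    (hZr.fderiv_right (m := 1) (WithTop.coe_le_coe.2 le_top)).differentiableAt (by simp)
  have hG := D.differentiableAt_christoffel x₀ hy
  rw [D.chartPull_cov x₀ hy hK, hev.fderiv_eq, hev.eq_of_nhds,
    fderiv_fun_add (hZd2.clm_apply (differentiableAt_const v))
      ((hG.clm_apply hZd).clm_apply (differentiableAt_const v)),
    fderiv_clm_apply hZd2 (differentiableAt_const v),
    fderiv_clm_apply (hG.clm_apply hZd) (differentiableAt_const v), fderiv_clm_apply hG hZd]
  simp
  abel

/-- The curvature in a chart. -/
theorem chartPull_curvature [T2Space M] (x₀ : M) {y : EuclideanSpace ℝ (Fin n)}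
    (hy : y ∈ (extChartAt (𝓡 n) x₀).target) (u v w : EuclideanSpace ℝ (Fin n)) :
    chartPull x₀ _ (D.curvature (chartPush x₀ y w) (chartPush x₀ y u) (chartPush x₀ y v)) =
      fderiv ℝ (D.christoffel x₀) y u w v - fderiv ℝ (D.christoffel x₀) y v w u +
        D.christoffel x₀ y (D.christoffel x₀ y w v) u -
        D.christoffel x₀ y (D.christoffel x₀ y w u) v := by
  have hp := (extChartAt (𝓡 n) x₀).map_target hy
  -- `curvature` extends the vector by a field constant in the chart centred at the point itself,
  -- not in the chart at `x₀`. Its derivatives in the latter need not vanish, but they cancel, so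
  -- only its value `hw` is needed.
  obtain ⟨s, hs, hZ⟩ := exists_smoothFieldOn_coordField (chartPush x₀ y w)
  have h := D.curvature_apply (chartPush x₀ y w) (differentiableFieldAt_chartFrame x₀ hp u)
    (differentiableFieldAt_chartFrame x₀ hp v)
  rw [chartFrame_apply_symm x₀ hy, chartFrame_apply_symm x₀ hy] at h
  have hw : chartRep x₀ (coordField (chartPush x₀ y w)) y = w := by
    rw [chartRep, coordField_self, chartPull_chartPush x₀ hy]
  have hZr := contDiffAt_chartRep x₀ hy (hZ.contMDiffAt hs)
  have hsymm := (hZr.isSymmSndFDerivAt minSmoothness_two_le_infty).eq u v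
  rw [h, curvatureField, mlieBracket_chartFrame x₀ hp, map_zero, sub_zero, map_sub,
    chartFrame_apply_symm x₀ hy, chartFrame_apply_symm x₀ hy,
    D.chartPull_cov_cov x₀ hy hs hZ, D.chartPull_cov_cov x₀ hy hs hZ, hw, hsymm]
  abel

/-- The derivative of the chart centred at `x₀` as a linear equivalence. -/
def _root_.chartPullEquiv (x₀ : M) {y : EuclideanSpace ℝ (Fin n)}
    (hy : y ∈ (extChartAt (𝓡 n) x₀).target) :
    TangentSpace (𝓡 n) ((extChartAt (𝓡 n) x₀).symm y) ≃ₗ[ℝ] EuclideanSpace ℝ (Fin n) :=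
  LinearEquiv.ofLinearMap (chartPull x₀ ((extChartAt (𝓡 n) x₀).symm y)).toLinearMap
    (chartPush x₀ y).toLinearMap
    (LinearMap.ext fun w ↦ chartPull_chartPush x₀ hy w)
    (LinearMap.ext fun w ↦ chartPush_chartPull x₀ hy w)

/-- By the symmetry of `Γ`, the endomorphism `s ↦ R(s, v) w - R(s, w) v` is `∂_w Γ_v - ∂_v Γ_w +
[Γ_w, Γ_v]`, where `Γ_v` is `Γ` with one argument equal to `v`. The commutator has trace zero. -/
theorem ricci_sub_ricci_swap [T2Space M] (x₀ : M) {y : EuclideanSpace ℝ (Fin n)}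
    (hy : y ∈ (extChartAt (𝓡 n) x₀).target) (v w : EuclideanSpace ℝ (Fin n)) :
    D.ricci _ (chartPush x₀ y v) (chartPush x₀ y w) -
        D.ricci _ (chartPush x₀ y w) (chartPush x₀ y v) =
      traceCLM _ (fderiv ℝ (D.christoffel x₀) y w v) -
        traceCLM _ (fderiv ℝ (D.christoffel x₀) y v w) := by
  have hric : ∀ v w : EuclideanSpace ℝ (Fin n),
      D.ricci _ (chartPush x₀ y v) (chartPush x₀ y w) = LinearMap.trace ℝ _
        ((chartPullEquiv x₀ hy).conj (D.curvatureEnd (chartPush x₀ y v) (chartPush x₀ y w))) := by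
    intro v w
    rw [LinearMap.trace_conj']
    rfl
  have hcomm := LinearMap.trace_comp_comm' (R := ℝ)
    (D.christoffel x₀ y v : EuclideanSpace ℝ (Fin n) →ₗ[ℝ] EuclideanSpace ℝ (Fin n))
    (D.christoffel x₀ y w : EuclideanSpace ℝ (Fin n) →ₗ[ℝ] EuclideanSpace ℝ (Fin n))
  have hc : ∀ v w s : EuclideanSpace ℝ (Fin n), (chartPullEquiv x₀ hy).conj
      (D.curvatureEnd (chartPush x₀ y v) (chartPush x₀ y w)) s =
      fderiv ℝ (D.christoffel x₀) y s w v - fderiv ℝ (D.christoffel x₀) y v w s +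
        D.christoffel x₀ y (D.christoffel x₀ y w v) s -
        D.christoffel x₀ y (D.christoffel x₀ y w s) v :=
    fun v w s ↦ D.chartPull_curvature x₀ hy s v w
  have hop : (chartPullEquiv x₀ hy).conj
        (D.curvatureEnd (chartPush x₀ y v) (chartPush x₀ y w)) -
      (chartPullEquiv x₀ hy).conj (D.curvatureEnd (chartPush x₀ y w) (chartPush x₀ y v)) =
      ((fderiv ℝ (D.christoffel x₀) y w v : EuclideanSpace ℝ (Fin n) →L[ℝ] _) :
        EuclideanSpace ℝ (Fin n) →ₗ[ℝ] EuclideanSpace ℝ (Fin n)) -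
      ((fderiv ℝ (D.christoffel x₀) y v w : EuclideanSpace ℝ (Fin n) →L[ℝ] _) :
        EuclideanSpace ℝ (Fin n) →ₗ[ℝ] EuclideanSpace ℝ (Fin n)) +
      ((D.christoffel x₀ y w : EuclideanSpace ℝ (Fin n) →ₗ[ℝ] EuclideanSpace ℝ (Fin n)) ∘ₗ
          (D.christoffel x₀ y v : EuclideanSpace ℝ (Fin n) →ₗ[ℝ] EuclideanSpace ℝ (Fin n)) -
        (D.christoffel x₀ y v : EuclideanSpace ℝ (Fin n) →ₗ[ℝ] EuclideanSpace ℝ (Fin n)) ∘ₗ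
          (D.christoffel x₀ y w : EuclideanSpace ℝ (Fin n) →ₗ[ℝ] EuclideanSpace ℝ (Fin n))) := by
    ext1 s
    simp only [LinearMap.sub_apply, LinearMap.add_apply, LinearMap.comp_apply,
      ContinuousLinearMap.coe_coe, hc]
    rw [D.fderiv_christoffel_symm x₀ hy s w v, D.christoffel_symm x₀ hy w v,
      D.christoffel_symm x₀ hy (D.christoffel x₀ y w s) v,
      D.christoffel_symm x₀ hy (D.christoffel x₀ y v s) w]
    abel
  have htr := congrArg (LinearMap.trace ℝ (EuclideanSpace ℝ (Fin n))) hop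
  rw [LinearMap.map_sub, LinearMap.map_add, LinearMap.map_sub, LinearMap.map_sub, hcomm,
    sub_self, add_zero] at htr
  rw [hric, hric, htr, traceCLM_apply, traceCLM_apply]

/-- Skew-symmetrising `(n R_{ab} + R_{ba}) / (n² - 1)` leaves the factor `(n - 1) / (n² - 1) = 1 /
(n + 1)`. -/
theorem beta_chartPush [T2Space M] (hn : 2 ≤ n) (x₀ : M) {y : EuclideanSpace ℝ (Fin n)}
    (hy : y ∈ (extChartAt (𝓡 n) x₀).target) (m : Fin 2 → EuclideanSpace ℝ (Fin n)) :
    formInChart D.beta x₀ y m = ((n : ℝ) + 1)⁻¹ *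
      (traceCLM _ (fderiv ℝ (D.christoffel x₀) y (m 0) (m 1)) -
        traceCLM _ (fderiv ℝ (D.christoffel x₀) y (m 1) (m 0))) := by
  have h2 : (2 : ℝ) ≤ n := by exact_mod_cast hn
  have h3 : ((n : ℝ) ^ 2 - 1) ≠ 0 := by nlinarith
  have h4 : ((n : ℝ) + 1) ≠ 0 := by positivity
  rw [← D.ricci_sub_ricci_swap x₀ hy]
  change D.schouten _ (chartPush x₀ y (m 1)) (chartPush x₀ y (m 0)) -
    D.schouten _ (chartPush x₀ y (m 0)) (chartPush x₀ y (m 1)) = _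
  simp only [schouten, LinearMap.smul_apply, LinearMap.add_apply, LinearMap.flip_apply,
    smul_eq_mul]
  field_simp
  ring

/-- The trace `Γ_{ac}^c` of the Christoffel symbols in the chart centred at `x₀`. -/
def christoffelTrace (x₀ : M) (y : EuclideanSpace ℝ (Fin n)) : EuclideanSpace ℝ (Fin n) →L[ℝ] ℝ :=
  traceCLM _ ∘L D.christoffel x₀ y

theorem contDiffOn_christoffelTrace [T2Space M] (x₀ : M) :
    ContDiffOn ℝ ∞ (D.christoffelTrace x₀) (extChartAt (𝓡 n) x₀).target :=
  contDiffOn_const.clm_comp (D.contDiffOn_christoffel x₀)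

theorem fderiv_christoffelTrace [T2Space M] (x₀ : M) {y : EuclideanSpace ℝ (Fin n)}
    (hy : y ∈ (extChartAt (𝓡 n) x₀).target) (u v : EuclideanSpace ℝ (Fin n)) :
    fderiv ℝ (D.christoffelTrace x₀) y u v = traceCLM _ (fderiv ℝ (D.christoffel x₀) y u v) := by
  unfold christoffelTrace
  rw [fderiv_clm_comp (differentiableAt_const _) (D.differentiableAt_christoffel x₀ hy)]
  simp

/-- The `1`-form `Γ_{ac}^c / (n + 1)` in the chart centred at `x₀`. -/
def chartPotential (x₀ : M) (y : EuclideanSpace ℝ (Fin n)) :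
    EuclideanSpace ℝ (Fin n) [⋀^Fin 1]→L[ℝ] ℝ :=
  ContinuousAlternatingMap.ofSubsingleton ℝ _ ℝ (0 : Fin 1)
    (((n : ℝ) + 1)⁻¹ • D.christoffelTrace x₀ y)

theorem contDiffOn_chartPotential [T2Space M] (x₀ : M) :
    ContDiffOn ℝ ∞ (D.chartPotential x₀) (extChartAt (𝓡 n) x₀).target :=
  (ContinuousAlternatingMap.ofSubsingletonLIE (𝕜 := ℝ) (E := EuclideanSpace ℝ (Fin n)) (F := ℝ)
    (0 : Fin 1)).contDiff.comp_contDiffOn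
      ((D.contDiffOn_christoffelTrace x₀).const_smul _)

theorem formInChart_beta [T2Space M] (hn : 2 ≤ n) (x₀ : M) {y : EuclideanSpace ℝ (Fin n)}
    (hy : y ∈ (extChartAt (𝓡 n) x₀).target) :
    formInChart D.beta x₀ y = extDeriv (D.chartPotential x₀) y := by
  have hd : DifferentiableAt ℝ (D.christoffelTrace x₀) y :=
    ((D.contDiffOn_christoffelTrace x₀).contDiffAt
      ((isOpen_extChartAt_target x₀).mem_nhds hy)).differentiableAt (by simp)
  ext m
  unfold chartPotential
  rw [extDeriv_ofSubsingleton_apply (hd.fun_const_smul _), D.beta_chartPush hn x₀ hy,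
    fderiv_fun_const_smul hd]
  simp only [smul_apply, smul_eq_mul, D.fderiv_christoffelTrace x₀ hy]
  ring

/-- Both parts are local, and in each chart `β` is the exterior derivative of a smooth form. -/
theorem beta_mem_closedForms [T2Space M] (hn : 2 ≤ n) : D.beta ∈ closedForms n M 2 := by
  refine ⟨fun x₀ ↦ ?_, ?_⟩
  · refine ContDiffOn.congr ?_ fun y hy ↦ D.formInChart_beta hn x₀ hy
    have h := (D.contDiffOn_chartPotential x₀).fderiv_of_isOpen (isOpen_extChartAt_target x₀)
      (m := ∞) (by simp)
    exact (ContinuousAlternatingMap.alternatizeUncurryFinCLM ℝ (EuclideanSpace ℝ (Fin n))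
      ℝ).contDiff.comp_contDiffOn h
  · funext x
    have hx := mem_extChartAt_target (I := 𝓡 n) x
    have hev : formInChart D.beta x =ᶠ[𝓝 (extChartAt (𝓡 n) x x)]
        extDeriv (D.chartPotential x) := by
      filter_upwards [(isOpen_extChartAt_target x).mem_nhds hx] with z hz
      exact D.formInChart_beta hn x hz
    have h := extDeriv_extDeriv_apply ((D.contDiffOn_chartPotential x).contDiffAt
      ((isOpen_extChartAt_target x).mem_nhds hx)) minSmoothness_two_le_infty
    unfold formExtDeriv
    rw [hev.extDeriv_eq, h]
    rfl

end TorsionFreeConnection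

end ChartCurvature

/-! ### Projective changes -/

section ProjectiveChange

/-- A symmetric bilinear map `A` for which every `A v v` is proportional to `v` is a symmetrised
product with a linear form. -/
theorem exists_linearForm_of_forall_apply_self {E : Type*} [AddCommGroup E] [Module ℝ E]
    (A : E →ₗ[ℝ] E →ₗ[ℝ] E) (hsymm : ∀ v w, A v w = A w v)
    (hA : ∀ v, ∃ μ : ℝ, A v v = μ • v) :
    ∃ l : E →ₗ[ℝ] ℝ, ∀ v w, A v w = l v • w + l w • v := by
  classical
  choose μ hμ using hA
  -- The factor `μ 0` is arbitrary, so the value at `0` must be prescribed. The halving comes from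
  -- `A v v = 2 l(v) v` on the diagonal of the desired formula.
  let l : E → ℝ := fun v ↦ if v = 0 then 0 else μ v / 2
  have hl0 : l 0 = 0 := if_pos rfl
  have hl : ∀ v, A v v = (2 * l v) • v := by
    intro v
    by_cases hv : v = 0
    · simp [hv]
    · rw [hμ v]
      simp only [l, if_neg hv]
      congr 1
      ring
  have hsmul : ∀ (c : ℝ) v, l (c • v) = c * l v := by
    intro c v
    by_cases hv : v = 0
    · simp [hv, hl0]
    by_cases hc : c = 0
    · simp [hc, hl0]
    have h := hl (c • v)
    rw [map_smul, map_smul, LinearMap.smul_apply, hl v, smul_smul, smul_smul, smul_smul] at h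
    have h2 := smul_left_injective ℝ hv h
    have h3 : c * (l (c • v) - c * l v) = 0 := by linear_combination -h2 / 2
    have h4 := (mul_eq_zero.1 h3).resolve_left hc
    linarith
  have hadd : ∀ v w, l (v + w) = l v + l w := by
    intro v w
    -- For independent `v`, `w`, the parallelogram identity `A(v+w, v+w) + A(v-w, v-w) = 2 A(v, v) +
    -- 2 A(w, w)` can be compared coefficient by coefficient, and adding the two resulting equations
    -- gives additivity. For dependent vectors, additivity reduces to homogeneity.
    by_cases hind : LinearIndependent ℝ ![v, w]
    · rw [LinearIndependent.pair_iff] at hind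
      have h1 := hl (v + w)
      have h2 := hl (v - w)
      simp only [map_add, map_sub, LinearMap.add_apply, LinearMap.sub_apply, hl v, hl w,
        hsymm w v] at h1 h2
      have h3 : (l (v + w) + l (v - w) - 2 * l v) • v +
          (l (v + w) - l (v - w) - 2 * l w) • w = 0 := by
        have h4 : (2 * l (v + w)) • (v + w) + (2 * l (v - w)) • (v - w) -
            ((4 * l v) • v + (4 * l w) • w) = 0 := by
          rw [← h1, ← h2]
          module
        have h5 : (2 : ℝ) • ((l (v + w) + l (v - w) - 2 * l v) • v +
            (l (v + w) - l (v - w) - 2 * l w) • w) = 0 := by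
          rw [← h4]
          module
        exact (smul_eq_zero.1 h5).resolve_left two_ne_zero
      obtain ⟨h6, h7⟩ := hind _ _ h3
      linarith
    · rw [LinearIndependent.pair_iff] at hind
      push Not at hind
      obtain ⟨s, t, hst, hne⟩ := hind
      by_cases ht : t = 0
      · have hs : s ≠ 0 := fun hs ↦ hne hs ht
        rw [ht, zero_smul, add_zero] at hst
        have hv : v = 0 := (smul_eq_zero.1 hst).resolve_left hs
        simp [hv, hl0]
      · have hw : w = (-(s / t)) • v := by
          have : t • w = (-s) • v := by
            rw [neg_smul, eq_neg_iff_add_eq_zero, add_comm, hst]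
          rw [← inv_smul_smul₀ ht w, this, smul_smul]
          congr 1
          field_simp
        have : v + w = (1 + -(s / t)) • v := by rw [add_smul, one_smul, hw]
        rw [this, hsmul, hw, hsmul]
        ring
  refine ⟨{ toFun := l, map_add' := hadd, map_smul' := hsmul }, fun v w ↦ ?_⟩
  change A v w = l v • w + l w • v
  have h := hl (v + w)
  simp only [map_add, LinearMap.add_apply, hl v, hl w, hsymm w v, hadd] at h
  have h2 : (2 : ℝ) • A v w = (2 : ℝ) • (l v • w + l w • v) := by
    have : (2 : ℝ) • A v w = ((2 * l v) • v + A v w + (A v w + (2 * l w) • w)) -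
      (2 * l v) • v - (2 * l w) • w := by module
    rw [this, h]
    module
  exact smul_right_injective E two_ne_zero h2

variable {n : ℕ} {M : Type*} [TopologicalSpace M] [ChartedSpace (EuclideanSpace ℝ (Fin n)) M]

theorem formInChart_one_apply (Υ : FormField n M 1) (x₀ : M) (y u : EuclideanSpace ℝ (Fin n)) :
    Υ ((extChartAt (𝓡 n) x₀).symm y) ![chartPush x₀ y u] = formInChart Υ x₀ y (fun _ ↦ u) := by
  change _ = Υ _ (fun _ ↦ chartPush x₀ y u)
  congr 1
  funext i
  fin_cases i
  rfl

variable [IsManifold (𝓡 n) ∞ M]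

/-- A form is determined at `x` by its coordinate expression in the chart centred at `x`. -/
theorem formInChart_comp_chartPull {k : ℕ} (α : FormField n M k) (x : M) :
    (formInChart α x (extChartAt (𝓡 n) x x)).compContinuousLinearMap
      (mfderiv (𝓡 n) 𝓘(ℝ, EuclideanSpace ℝ (Fin n)) (extChartAt (𝓡 n) x) x) = α x := by
  ext m
  have key : ∀ (q : M) (_ : q = x) (m' : Fin k → TangentSpace (𝓡 n) q),
      (∀ i, chartPull x q (m' i) = chartPull x x (m i)) → α q m' = α x m := by
    rintro q rfl m' h
    congr 1
    funext i
    rw [← chartPull_self q (m' i), h, chartPull_self]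
  exact key _ (extChartAt_to_inv x) (fun i ↦ chartPush x _ (chartPull x x (m i)))
    fun i ↦ chartPull_chartPush x (mem_extChartAt_target x) _

namespace TorsionFreeConnection

variable {D D' : TorsionFreeConnection n M} {Υ : FormField n M 1}

/-- The endomorphism added to `Γ_w` is `u ↦ υ(u) w + υ(w) u`. Its first summand has trace `υ(w)` and
its second `n υ(w)`, so the traces of the two connections recover `υ` after division by `n + 1`. -/
theorem IsProjectiveChange.formInChart_eq (h : D.IsProjectiveChange D' Υ) (x₀ : M)
    {y : EuclideanSpace ℝ (Fin n)} (hy : y ∈ (extChartAt (𝓡 n) x₀).target) :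
    formInChart Υ x₀ y = D'.chartPotential x₀ y - D.chartPotential x₀ y := by
  have hp := (extChartAt (𝓡 n) x₀).map_target hy
  obtain ⟨υ, hυ⟩ := (ContinuousAlternatingMap.ofSubsingleton ℝ (EuclideanSpace ℝ (Fin n)) ℝ
    (0 : Fin 1)).surjective (formInChart Υ x₀ y)
  have hυ1 : ∀ u, Υ ((extChartAt (𝓡 n) x₀).symm y) ![chartPush x₀ y u] = υ u := by
    intro u
    rw [formInChart_one_apply, ← hυ]
    rfl
  have hΓ : ∀ w, D'.christoffel x₀ y w = D.christoffel x₀ y w + υ.smulRight w +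
      υ w • ContinuousLinearMap.id ℝ (EuclideanSpace ℝ (Fin n)) := by
    intro w
    ext1 u
    have h1 := h (chartFrame x₀ w) _ (differentiableFieldAt_chartFrame x₀ hp w) (chartPush x₀ y u)
    have h2 := congrArg (chartPull x₀ _) h1
    rw [map_add, map_add, map_smul, map_smul, chartFrame_apply_symm x₀ hy, hυ1, hυ1,
      D.chartPull_cov_chartFrame x₀ hy, D'.chartPull_cov_chartFrame x₀ hy,
      chartPull_chartPush x₀ hy, chartPull_chartPush x₀ hy] at h2
    exact h2
  have htr : ∀ w, D'.christoffelTrace x₀ y w =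
      D.christoffelTrace x₀ y w + ((n : ℝ) + 1) * υ w := by
    intro w
    have h1 : traceCLM _ (υ.smulRight w) = υ w :=
      LinearMap.trace_smulRight (υ : EuclideanSpace ℝ (Fin n) →ₗ[ℝ] ℝ) w
    have h2 : traceCLM _ (ContinuousLinearMap.id ℝ (EuclideanSpace ℝ (Fin n))) = n := by
      rw [traceCLM_apply, ContinuousLinearMap.coe_id, LinearMap.trace_id]
      simp
    change traceCLM _ (D'.christoffel x₀ y w) = traceCLM _ (D.christoffel x₀ y w) + _
    rw [hΓ w, map_add, map_add, map_smul, h1, h2, smul_eq_mul]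
    ring
  rw [← hυ]
  ext m
  have h4 : ((n : ℝ) + 1) ≠ 0 := by positivity
  change υ (m 0) = ((n : ℝ) + 1)⁻¹ * D'.christoffelTrace x₀ y (m 0) -
    ((n : ℝ) + 1)⁻¹ * D.christoffelTrace x₀ y (m 0)
  rw [htr]
  field_simp
  ring

/-- Smoothness is automatic: the two connections determine the form through their smooth Christoffel
traces. This is what permits `Υ` to be constructed pointwise later. -/
theorem IsProjectiveChange.mem_smoothForms [T2Space M] (h : D.IsProjectiveChange D' Υ) :
    Υ ∈ smoothForms n M 1 := fun x₀ ↦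
  ((D'.contDiffOn_chartPotential x₀).sub (D.contDiffOn_chartPotential x₀)).congr
    fun _ hy ↦ h.formInChart_eq x₀ hy

theorem IsProjectiveChange.beta_eq [T2Space M] (hn : 2 ≤ n) (h : D.IsProjectiveChange D' Υ) :
    D'.beta = D.beta + formExtDeriv Υ := by
  funext x
  have hx := mem_extChartAt_target (I := 𝓡 n) x
  have hU := (isOpen_extChartAt_target (I := 𝓡 n) x).mem_nhds hx
  have hd : DifferentiableAt ℝ (D.chartPotential x) (extChartAt (𝓡 n) x x) :=
    ((D.contDiffOn_chartPotential x).contDiffAt hU).differentiableAt (by simp)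
  have hev : D'.chartPotential x =ᶠ[𝓝 (extChartAt (𝓡 n) x x)]
      D.chartPotential x + formInChart Υ x := by
    filter_upwards [hU] with z hz
    rw [Pi.add_apply, h.formInChart_eq x hz]
    abel
  have hb : formInChart D'.beta x (extChartAt (𝓡 n) x x) =
      formInChart D.beta x (extChartAt (𝓡 n) x x) +
        extDeriv (formInChart Υ x) (extChartAt (𝓡 n) x x) := by
    rw [D'.formInChart_beta hn x hx, D.formInChart_beta hn x hx, hev.extDeriv_eq,
      extDeriv_add hd (differentiableAt_formInChart h.mem_smoothForms x)]
  rw [FormField.add_apply, ← formInChart_comp_chartPull D'.beta x,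
    ← formInChart_comp_chartPull D.beta x, hb]
  rfl

end TorsionFreeConnection

end ProjectiveChange

/-! ### Geodesics -/

section Geodesics

theorem iteratedDeriv_two_comp {E F : Type*} [NormedAddCommGroup E] [NormedSpace ℝ E]
    [NormedAddCommGroup F] [NormedSpace ℝ F] {f : E → F} {c : ℝ → E} {t : ℝ}
    (hf : ContDiffAt ℝ 2 f (c t)) (hc : ContDiffAt ℝ 2 c t) :
    iteratedDeriv 2 (fun s ↦ f (c s)) t =
      fderiv ℝ (fderiv ℝ f) (c t) (deriv c t) (deriv c t) +
        fderiv ℝ f (c t) (iteratedDeriv 2 c t) := by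
  have hev : deriv (fun s ↦ f (c s)) =ᶠ[𝓝 t] fun s ↦ fderiv ℝ f (c s) (deriv c s) := by
    have h1 := hc.continuousAt.eventually (hf.eventually (by simp))
    filter_upwards [h1, hc.eventually (by simp)] with s hs hcs
    exact ((hs.differentiableAt (by simp)).hasFDerivAt.comp_hasDerivAt s
      (hcs.differentiableAt (by simp)).hasDerivAt).deriv
  have hf2 : HasFDerivAt (fderiv ℝ f) (fderiv ℝ (fderiv ℝ f) (c t)) (c t) :=
    ((hf.fderiv_right (m := 1) (by norm_num)).differentiableAt (by simp)).hasFDerivAt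
  have hc1 : HasDerivAt c (deriv c t) t := (hc.differentiableAt (by simp)).hasDerivAt
  have hc2 : HasDerivAt (deriv c) (iteratedDeriv 2 c t) t := by
    have h3 : DifferentiableAt ℝ (deriv c) t := by
      have h4 : DifferentiableAt ℝ (fderiv ℝ c) t :=
        (hc.fderiv_right (m := 1) (by norm_num)).differentiableAt (by simp)
      have h5 := h4.clm_apply (differentiableAt_const (1 : ℝ))
      simpa only [fderiv_apply_one_eq_deriv] using h5
    rw [iteratedDeriv_succ, iteratedDeriv_one]
    exact h3.hasDerivAt
  rw [iteratedDeriv_succ, iteratedDeriv_one, hev.deriv_eq]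
  exact ((hf2.comp_hasDerivAt t hc1).clm_apply hc2).deriv

theorem iteratedDeriv_two_scomp {F : Type*} [NormedAddCommGroup F] [NormedSpace ℝ F] {f : ℝ → F}
    {s : ℝ → ℝ} {t : ℝ} (hf : ContDiffAt ℝ 2 f (s t)) (hs : ContDiffAt ℝ 2 s t) :
    iteratedDeriv 2 (fun r ↦ f (s r)) t =
      (deriv s t) ^ 2 • iteratedDeriv 2 f (s t) + iteratedDeriv 2 s t • deriv f (s t) := by
  have h2 : fderiv ℝ (fderiv ℝ f) (s t) (1 : ℝ) (1 : ℝ) = iteratedDeriv 2 f (s t) := by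
    have := iteratedDeriv_two_comp (c := id) (t := s t) hf contDiffAt_id
    simpa [iteratedDeriv_succ, deriv_id'] using this.symm
  have hsmul : ∀ (B : ℝ →L[ℝ] F) (a : ℝ), B a = a • B 1 := fun B a ↦ by
    rw [← map_smul, smul_eq_mul, mul_one]
  rw [iteratedDeriv_two_comp hf hs, hsmul _ (iteratedDeriv 2 s t), fderiv_apply_one_eq_deriv,
    hsmul _ (deriv s t), ← h2, pow_two, mul_smul]
  congr 2
  rw [show deriv s t = deriv s t • (1 : ℝ) by simp, map_smul]
  simp

/-- An integral curve of a smooth vector field is smooth. -/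
theorem contDiffOn_of_hasDerivAt {F : Type*} [NormedAddCommGroup F] [NormedSpace ℝ F] {f : F → F}
    {U : Set F} (hf : ContDiffOn ℝ ∞ f U) {α : ℝ → F} {J : Set ℝ} (hJ : IsOpen J)
    (hU : MapsTo α J U) (hα : ∀ t ∈ J, HasDerivAt α (f (α t)) t) : ContDiffOn ℝ ∞ α J := by
  rw [contDiffOn_infty]
  intro k
  induction k with
  | zero =>
    exact contDiffOn_zero.2 fun t ht ↦ (hα t ht).continuousAt.continuousWithinAt
  | succ k ih =>
    push_cast
    rw [contDiffOn_succ_iff_deriv_of_isOpen hJ]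
    refine ⟨fun t ht ↦ (hα t ht).differentiableAt.differentiableWithinAt, by simp, ?_⟩
    refine ContDiffOn.congr (f := f ∘ α) ?_ fun t ht ↦ (hα t ht).deriv
    exact (hf.of_le (WithTop.coe_le_coe.2 le_top)).comp ih hU

variable {n : ℕ} {M : Type*} [TopologicalSpace M] [ChartedSpace (EuclideanSpace ℝ (Fin n)) M]
  [IsManifold (𝓡 n) ∞ M]

/-- Both fields have constant components in the chart at `p`; this links the field used to define
`acceleration` with the coordinate fields of a chart. -/
theorem coordField_eq_chartFrame {p q : M} (hq : q ∈ (extChartAt (𝓡 n) p).source)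
    (w : TangentSpace (𝓡 n) p) :
    TorsionFreeConnection.coordField w q = chartFrame p (chartPull p p w) q := by
  have hq' := hq
  rw [extChartAt_source] at hq'
  have hp' : p ∈ (chartAt (EuclideanSpace ℝ (Fin n)) p).source := mem_chart_source _ p
  have h1 : ∀ v : TangentSpace (𝓡 n) q, chartPull p q v =
      (trivializationAt (EuclideanSpace ℝ (Fin n)) (TangentSpace (𝓡 n) : M → Type _)
        p).continuousLinearMapAt ℝ q v := fun v ↦
    congr($(TangentBundle.continuousLinearMapAt_trivializationAt (I := 𝓡 n) hq') v).symm
  have h2 : chartPull p p w =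
      (trivializationAt (EuclideanSpace ℝ (Fin n)) (TangentSpace (𝓡 n) : M → Type _)
        p).continuousLinearMapAt ℝ p w :=
    congr($(TangentBundle.continuousLinearMapAt_trivializationAt (I := 𝓡 n) hp') w).symm
  rw [← inverse_chartPull_apply p hq (TorsionFreeConnection.coordField w q), h1,
    TorsionFreeConnection.coordField,
    Trivialization.continuousLinearMapAt_symmL _ (by simpa using hq'), ← h2]
  rfl

namespace TorsionFreeConnection

variable (D : TorsionFreeConnection n M)

theorem velocity_symm_comp (x₀ : M) {c : ℝ → EuclideanSpace ℝ (Fin n)} {t : ℝ}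
    (hy : c t ∈ (extChartAt (𝓡 n) x₀).target) (hc : DifferentiableAt ℝ c t) :
    velocity (fun s ↦ (extChartAt (𝓡 n) x₀).symm (c s)) t = chartPush x₀ (c t) (deriv c t) := by
  have h := mfderiv_comp t ((contMDiffAt_symm_extChartAt x₀ hy).mdifferentiableAt (by simp))
    hc.mdifferentiableAt
  rw [mfderiv_eq_fderiv] at h
  have h2 := congr($h (1 : ℝ))
  rw [← fderiv_apply_one_eq_deriv]
  exact h2

/-- The geodesic equation in an arbitrary chart. -/
theorem acceleration_symm_comp (x₀ : M) {c : ℝ → EuclideanSpace ℝ (Fin n)} {t : ℝ}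
    (hy : c t ∈ (extChartAt (𝓡 n) x₀).target) (hc : ContDiffAt ℝ 2 c t) :
    D.acceleration (fun s ↦ (extChartAt (𝓡 n) x₀).symm (c s)) t = chartPush x₀ (c t)
      (iteratedDeriv 2 c t + D.christoffel x₀ (c t) (deriv c t) (deriv c t)) := by
  have hp := (extChartAt (𝓡 n) x₀).map_target hy
  set y := c t with hyc
  set p := (extChartAt (𝓡 n) x₀).symm y with hpdef
  set u := deriv c t with hu
  set V : TangentSpace (𝓡 n) p := chartPush x₀ y u with hV
  -- The acceleration is defined in the chart centred at the current point `p`, so the change of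
  -- charts from `x₀` to `p` enters.
  let τ : EuclideanSpace ℝ (Fin n) → EuclideanSpace ℝ (Fin n) :=
    fun z ↦ extChartAt (𝓡 n) p ((extChartAt (𝓡 n) x₀).symm z)
  have hnear : ∀ᶠ z in 𝓝 y, z ∈ (extChartAt (𝓡 n) x₀).target ∧
      (extChartAt (𝓡 n) x₀).symm z ∈ (extChartAt (𝓡 n) p).source :=
    Filter.Eventually.and ((isOpen_extChartAt_target x₀).mem_nhds hy)
      ((continuousAt_extChartAt_symm'' (I := 𝓡 n) hy).preimage_mem_nhds
        ((isOpen_extChartAt_source p).mem_nhds (mem_extChartAt_source p)))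
  have hτ : ContDiffAt ℝ ∞ τ y := by
    rw [← contMDiffAt_iff_contDiffAt]
    exact (contMDiffAt_extChartAt (x := p)).comp y (contMDiffAt_symm_extChartAt x₀ hy)
  have hDτ : ∀ z, z ∈ (extChartAt (𝓡 n) x₀).target →
      (extChartAt (𝓡 n) x₀).symm z ∈ (extChartAt (𝓡 n) p).source → ∀ e,
      fderiv ℝ τ z e = chartPull p _ (chartPush x₀ z e) := by
    intro z hz hzs e
    have h1 := mfderiv_comp z (mdifferentiableAt_extChartAt (I := 𝓡 n) (by simpa using hzs))
      ((contMDiffAt_symm_extChartAt x₀ hz).mdifferentiableAt (by simp))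
    have h2 : mfderiv 𝓘(ℝ, EuclideanSpace ℝ (Fin n)) 𝓘(ℝ, EuclideanSpace ℝ (Fin n)) τ z =
      fderiv ℝ τ z := mfderiv_eq_fderiv
    rw [← h2]
    exact congr($h1 e)
  have hZ := differentiableFieldAt_coordField V
  have hZd := differentiableAt_chartRep x₀ hy hZ
  have hZy : chartRep x₀ (coordField V) y = u := by
    rw [chartRep, coordField_self, hV, chartPull_chartPush x₀ hy]
  -- The field `coordField V` is constant in the chart at `p`. Differentiating this identity
  -- expresses the second derivative of `τ` through the first derivative of the field in the chart
  -- at `x₀`; that term then cancels between the coordinate acceleration and the covariant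
  -- derivative.
  have hconst : (fun z ↦ fderiv ℝ τ z (chartRep x₀ (coordField V) z)) =ᶠ[𝓝 y]
      fun _ ↦ chartPull p p V := by
    filter_upwards [hnear] with z hz
    rw [hDτ z hz.1 hz.2, chartRep, chartPush_chartPull x₀ hz.1,
      coordField_eq_chartFrame hz.2, chartPull_chartFrame p hz.2]
  have hτ2 : DifferentiableAt ℝ (fderiv ℝ τ) y :=
    (hτ.fderiv_right (m := 1) (WithTop.coe_le_coe.2 le_top)).differentiableAt (by simp)
  have hrel : fderiv ℝ (fderiv ℝ τ) y u u =
      - fderiv ℝ τ y (fderiv ℝ (chartRep x₀ (coordField V)) y u) := by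
    have h1 := congr($(hconst.fderiv_eq (𝕜 := ℝ)) u)
    rw [fderiv_clm_apply hτ2 hZd, hZy] at h1
    rw [eq_neg_iff_add_eq_zero, add_comm]
    simpa using h1
  have hacc : coordAcceleration (fun s ↦ (extChartAt (𝓡 n) x₀).symm (c s)) t =
      chartPull p p (chartPush x₀ y
        (iteratedDeriv 2 c t - fderiv ℝ (chartRep x₀ (coordField V)) y u)) := by
    have h1 : coordAcceleration (fun s ↦ (extChartAt (𝓡 n) x₀).symm (c s)) t =
      iteratedDeriv 2 (fun s ↦ τ (c s)) t := rfl
    rw [h1, iteratedDeriv_two_comp (hτ.of_le (WithTop.coe_le_coe.2 le_top)) hc, ← hyc, ← hu, hrel,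
      ← hDτ y hy (mem_extChartAt_source p), map_sub]
    abel
  have hvel := velocity_symm_comp x₀ hy (hc.differentiableAt (by simp))
  have hcov := D.cov_eq x₀ hy hZ u
  rw [hZy] at hcov
  unfold acceleration
  rw [hvel, hacc, chartPull_self]
  change chartPush x₀ y _ + D.cov (coordField V) p (chartPush x₀ y u) = _
  rw [hcov, ← map_add]
  congr 1
  abel

/-- The geodesic equation is written as a first-order system for position and velocity in the chart
at `x`, and solved by Picard–Lindelöf. The initial velocity is compared through `chartPull` because
`γ t` and `x` are not definitionally equal. -/
theorem exists_isGeodesicOn [T2Space M] (x : M) (v : TangentSpace (𝓡 n) x) :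
    ∃ (γ : ℝ → M) (J : Set ℝ) (t : ℝ), IsOpen J ∧ J.OrdConnected ∧ t ∈ J ∧ D.IsGeodesicOn γ J ∧
      γ t = x ∧ chartPull x (γ t) (velocity γ t) = chartPull x x v := by
  set U := (extChartAt (𝓡 n) x).target with hUdef
  have hUo : IsOpen U := isOpen_extChartAt_target x
  set w := chartPull x x v with hw
  let F : EuclideanSpace ℝ (Fin n) × EuclideanSpace ℝ (Fin n) →
      EuclideanSpace ℝ (Fin n) × EuclideanSpace ℝ (Fin n) :=
    fun z ↦ (z.2, - D.christoffel x z.1 z.2 z.2)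
  have hVo : IsOpen (U ×ˢ (univ : Set (EuclideanSpace ℝ (Fin n)))) := hUo.prod isOpen_univ
  have hF : ContDiffOn ℝ ∞ F (U ×ˢ univ) := by
    have h1 : ContDiffOn ℝ ∞ (fun z : EuclideanSpace ℝ (Fin n) × EuclideanSpace ℝ (Fin n) ↦
        D.christoffel x z.1) (U ×ˢ univ) :=
      (D.contDiffOn_christoffel x).comp contDiff_fst.contDiffOn fun z hz ↦ hz.1
    exact contDiff_snd.contDiffOn.prodMk
      ((h1.clm_apply contDiff_snd.contDiffOn).clm_apply contDiff_snd.contDiffOn).neg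
  have h0 : (extChartAt (𝓡 n) x x, w) ∈ U ×ˢ (univ : Set (EuclideanSpace ℝ (Fin n))) :=
    ⟨mem_extChartAt_target x, mem_univ _⟩
  obtain ⟨α, hα0, ε, hε, hα⟩ :=
    ((hF.contDiffAt (hVo.mem_nhds h0)).of_le
      (WithTop.coe_le_coe.2 le_top)).exists_forall_mem_closedBall_exists_eq_forall_mem_Ioo_hasDerivAt₀
      0
  rw [zero_sub, zero_add] at hα
  have hcont : ContinuousAt α 0 := (hα 0 ⟨by linarith, hε⟩).continuousAt
  -- The local solution could leave the domain of the chart; by continuity it stays inside for a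
  -- shorter time `δ`.
  obtain ⟨δ, hδ, hδU⟩ := Metric.mem_nhds_iff.1
    (hcont.preimage_mem_nhds (hVo.mem_nhds (by rw [hα0]; exact h0)))
  rw [Real.ball_eq_Ioo, zero_sub, zero_add] at hδU
  set J := Ioo (-(min ε δ)) (min ε δ) with hJ
  have hJo : IsOpen J := isOpen_Ioo
  have hm : 0 < min ε δ := lt_min hε hδ
  have h0J : (0 : ℝ) ∈ J := ⟨by linarith, hm⟩
  have hαJ : ∀ t ∈ J, HasDerivAt α (F (α t)) t := fun t ht ↦
    hα t ⟨by linarith [ht.1, min_le_left ε δ], by linarith [ht.2, min_le_left ε δ]⟩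
  have hmaps : MapsTo α J (U ×ˢ univ) := fun t ht ↦
    hδU ⟨by linarith [ht.1, min_le_right ε δ], by linarith [ht.2, min_le_right ε δ]⟩
  have hαs := contDiffOn_of_hasDerivAt hF hJo hmaps hαJ
  let c : ℝ → EuclideanSpace ℝ (Fin n) := fun t ↦ (α t).1
  have hc : ContDiffOn ℝ ∞ c J := contDiff_fst.comp_contDiffOn hαs
  have hc1 : ∀ t ∈ J, HasDerivAt c (α t).2 t := fun t ht ↦ (hαJ t ht).fst
  have hc2 : ∀ t ∈ J, iteratedDeriv 2 c t = - D.christoffel x (c t) (α t).2 (α t).2 := by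
    intro t ht
    have hev : deriv c =ᶠ[𝓝 t] fun s ↦ (α s).2 := by
      filter_upwards [hJo.mem_nhds ht] with s hs
      exact (hc1 s hs).deriv
    rw [iteratedDeriv_succ, iteratedDeriv_one, hev.deriv_eq]
    have h2 : HasDerivAt (fun s ↦ (α s).2) (F (α t)).2 t := (hαJ t ht).snd
    exact h2.deriv
  have hcU : ∀ t ∈ J, c t ∈ U := fun t ht ↦ (hmaps ht).1
  have hc0 : c 0 = extChartAt (𝓡 n) x x := congrArg Prod.fst hα0
  refine ⟨fun t ↦ (extChartAt (𝓡 n) x).symm (c t), J, 0, hJo, ordConnected_Ioo, h0J,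
    ⟨?_, ?_⟩, ?_, ?_⟩
  · exact (contMDiffOn_extChartAt_symm x).comp hc.contMDiffOn fun t ht ↦ hcU t ht
  · intro t ht
    rw [D.acceleration_symm_comp x (hcU t ht)
      ((hc.contDiffAt (hJo.mem_nhds ht)).of_le (WithTop.coe_le_coe.2 le_top)), hc2 t ht,
      (hc1 t ht).deriv, neg_add_cancel, map_zero]
  · simp only [hc0]
    exact extChartAt_to_inv x
  · rw [velocity_symm_comp x (hcU 0 h0J) (hc1 0 h0J).differentiableAt,
      chartPull_chartPush x (hcU 0 h0J), (hc1 0 h0J).deriv, hα0]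

end TorsionFreeConnection

end Geodesics

/-! ### Projectively equivalent connections -/

section ProjectiveEquivalence

variable {n : ℕ} {M : Type*} [TopologicalSpace M] [ChartedSpace (EuclideanSpace ℝ (Fin n)) M]
  [IsManifold (𝓡 n) ∞ M]

namespace TorsionFreeConnection

variable {D D' : TorsionFreeConnection n M}

theorem velocity_eq_deriv {γ : ℝ → M} {t : ℝ} (hγ : MDifferentiableAt 𝓘(ℝ, ℝ) (𝓡 n) γ t) :
    (deriv (fun s ↦ extChartAt (𝓡 n) (γ t) (γ s)) t : EuclideanSpace ℝ (Fin n)) =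
      velocity γ t := by
  have h1 := mfderiv_comp t
    (mdifferentiableAt_extChartAt (I := 𝓡 n) (mem_chart_source _ (γ t))) hγ
  have h2 : mfderiv 𝓘(ℝ, ℝ) 𝓘(ℝ, EuclideanSpace ℝ (Fin n))
    (fun s ↦ extChartAt (𝓡 n) (γ t) (γ s)) t = fderiv ℝ (fun s ↦ extChartAt (𝓡 n) (γ t) (γ s)) t :=
    mfderiv_eq_fderiv
  rw [← fderiv_apply_one_eq_deriv, ← h2]
  exact (congr($h1 (1 : ℝ))).trans (chartPull_self (γ t) (velocity γ t))

/-- The acceleration of a reparametrised curve. -/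
theorem acceleration_comp (D : TorsionFreeConnection n M) {γ : ℝ → M} {s : ℝ → ℝ} {t : ℝ}
    (hγ : ContMDiffAt 𝓘(ℝ, ℝ) (𝓡 n) ∞ γ (s t)) (hs : ContDiffAt ℝ ∞ s t) :
    D.acceleration (γ ∘ s) t = (deriv s t) ^ 2 • D.acceleration γ (s t) +
      iteratedDeriv 2 s t • velocity γ (s t) := by
  have hγd : MDifferentiableAt 𝓘(ℝ, ℝ) (𝓡 n) γ (s t) := hγ.mdifferentiableAt (by simp)
  have hsd : DifferentiableAt ℝ s t := hs.differentiableAt (by simp)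
  have hv : velocity (n := n) (γ ∘ s) t = deriv s t • velocity γ (s t) := by
    have h1 := mfderiv_comp t hγd hsd.mdifferentiableAt
    rw [mfderiv_eq_fderiv] at h1
    have h2 : fderiv ℝ s t (1 : ℝ) = deriv s t • (1 : ℝ) := by
      rw [fderiv_apply_one_eq_deriv, smul_eq_mul, mul_one]
    have h3 : velocity (n := n) (γ ∘ s) t = mfderiv 𝓘(ℝ, ℝ) (𝓡 n) γ (s t) (fderiv ℝ s t (1 : ℝ)) :=
      congr($h1 (1 : ℝ))
    rw [h3, h2]
    exact map_smul _ _ _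
  have hf : ContDiffAt ℝ 2 (fun r ↦ extChartAt (𝓡 n) (γ (s t)) (γ r)) (s t) := by
    have h1 : ContMDiffAt 𝓘(ℝ, ℝ) 𝓘(ℝ, EuclideanSpace ℝ (Fin n)) ∞
        (fun r ↦ extChartAt (𝓡 n) (γ (s t)) (γ r)) (s t) :=
      (contMDiffAt_extChartAt (x := γ (s t))).comp (s t) hγ
    exact (contMDiffAt_iff_contDiffAt.1 h1).of_le (WithTop.coe_le_coe.2 le_top)
  have ha := iteratedDeriv_two_scomp hf (hs.of_le (WithTop.coe_le_coe.2 le_top))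
  rw [velocity_eq_deriv hγd] at ha
  have hc : D.cov (coordField (velocity (γ ∘ s) t)) ((γ ∘ s) t) (velocity (γ ∘ s) t) =
      (deriv s t) ^ 2 • D.cov (coordField (velocity γ (s t))) (γ (s t)) (velocity γ (s t)) := by
    rw [hv, coordField_smul]
    change D.cov (deriv s t • coordField (velocity γ (s t))) (γ (s t))
      (deriv s t • velocity γ (s t)) = _
    rw [D.cov.isCovariantDerivativeOnUniv.smul_const _
      (differentiableFieldAt_coordField (velocity γ (s t))), smul_apply, map_smul, smul_smul,
      pow_two]
  unfold acceleration
  rw [hc, smul_add, add_right_comm]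
  exact congrArg₂ (· + ·) ha rfl

/-- The difference tensor of two connections. -/
def difference (D D' : TorsionFreeConnection n M) (x : M) :
    TangentSpace (𝓡 n) x →L[ℝ] TangentSpace (𝓡 n) x →L[ℝ] TangentSpace (𝓡 n) x :=
  D'.cov.isCovariantDerivativeOnUniv.difference D.cov.isCovariantDerivativeOnUniv x

theorem difference_apply {Z : (x : M) → TangentSpace (𝓡 n) x} {x : M}
    (hZ : DifferentiableFieldAt Z x) :
    difference D D' x (Z x) = D'.cov Z x - D.cov Z x :=
  IsCovariantDerivativeOn.difference_apply _ _ (mem_univ x) hZ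

/-- Exchanging the arguments costs each connection the same Lie bracket, which disappears from the
difference. -/
theorem difference_symm (x : M) (v w : TangentSpace (𝓡 n) x) :
    difference D D' x v w = difference D D' x w v := by
  have key : ∀ v w : TangentSpace (𝓡 n) x, difference D D' x v w =
      D'.cov (coordField v) x w - D.cov (coordField v) x w := by
    intro v w
    have h := difference_apply (D := D) (D' := D') (differentiableFieldAt_coordField v)
    rw [coordField_self] at h
    rw [h, sub_apply]
  have ht : ∀ D : TorsionFreeConnection n M,
      D.cov (coordField v) x w = D.cov (coordField w) x v +
        mlieBracket (𝓡 n) (coordField w) (coordField v) x := by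
    intro D
    have h := CovariantDerivative.torsion_eq_zero_iff D.cov |>.1 D.torsion_eq_zero
      (differentiableFieldAt_coordField w) (differentiableFieldAt_coordField v)
    rw [coordField_self, coordField_self] at h
    rw [← h]
    abel
  rw [key, key, ht D, ht D']
  abel

/-- Along a `D`-geodesic with velocity `v`, the difference tensor on `(v, v)` is the
`D'`-acceleration, since the coordinate accelerations cancel. A reparametrisation that kills this
acceleration forces it to be tangent to the curve. -/
theorem GeodesicsReparametriseTo.difference_apply_self [T2Space M]
    (h : D.GeodesicsReparametriseTo D') (x : M) (v : TangentSpace (𝓡 n) x) :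
    ∃ μ : ℝ, difference D D' x v v = μ • v := by
  obtain ⟨γ, J, t, hJ, hJc, ht, hγ, rfl, hv⟩ := D.exists_isGeodesicOn x v
  rw [chartPull_self, chartPull_self] at hv
  obtain ⟨s, J', hJ', -, hs, hs0, rfl, hγ'⟩ := h γ J hJ hJc hγ
  obtain ⟨r, hr, rfl⟩ := ht
  have hs' := hs0 r hr
  have h1 := D'.acceleration_comp (hγ.1.contMDiffAt (hJ.mem_nhds (mem_image_of_mem s hr)))
    (hs.contDiffAt (hJ'.mem_nhds hr))
  rw [hγ'.2 r hr] at h1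
  have h2 := hγ.2 (s r) (mem_image_of_mem s hr)
  have h3 : difference D D' (γ (s r)) v v =
      D'.acceleration γ (s r) - D.acceleration γ (s r) := by
    have h4 := difference_apply (D := D) (D' := D')
      (differentiableFieldAt_coordField (velocity γ (s r)))
    rw [coordField_self] at h4
    have hv' : v = velocity γ (s r) := hv.symm
    rw [hv', h4, sub_apply]
    unfold acceleration
    abel
  -- Solves `0 = s'² a + s'' v` for the `D'`-acceleration `a`; regularity of `s` permits the
  -- division.
  refine ⟨-((deriv s r) ^ 2)⁻¹ * iteratedDeriv 2 s r, ?_⟩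
  have hv' : velocity γ (s r) = v := hv
  rw [h3, h2, sub_zero]
  have h5 : (deriv s r) ^ 2 ≠ 0 := pow_ne_zero 2 hs'
  have h6 : (deriv s r) ^ 2 • D'.acceleration γ (s r) = - (iteratedDeriv 2 s r • v) := by
    rw [eq_neg_iff_add_eq_zero, ← hv']
    exact h1.symm
  rw [← inv_smul_smul₀ h5 (D'.acceleration γ (s r)), h6, smul_neg, smul_smul, neg_mul, neg_smul]

theorem GeodesicsReparametriseTo.exists_isProjectiveChange [T2Space M]
    (h : D.GeodesicsReparametriseTo D') : ∃ Υ : FormField n M 1, D.IsProjectiveChange D' Υ := by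
  have hx : ∀ x : M, ∃ l : TangentSpace (𝓡 n) x →ₗ[ℝ] ℝ, ∀ v w,
      difference D D' x v w = l v • w + l w • v := by
    intro x
    let A : TangentSpace (𝓡 n) x →ₗ[ℝ] TangentSpace (𝓡 n) x →ₗ[ℝ] TangentSpace (𝓡 n) x :=
      LinearMap.mk₂ ℝ (fun v w ↦ difference D D' x v w)
        (fun v w u ↦ by simp only [map_add, add_apply])
        (fun c w u ↦ by simp only [map_smul, smul_apply])
        (fun w u u' ↦ by simp only [map_add])
        (fun c w u ↦ by simp only [map_smul])
    exact exists_linearForm_of_forall_apply_self A (difference_symm x)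
      (h.difference_apply_self x)
  choose l hl using hx
  have hc : ∀ x, Continuous (l x) := fun x ↦
    (show EuclideanSpace ℝ (Fin n) →ₗ[ℝ] ℝ from l x).continuous_of_finiteDimensional
  refine ⟨fun x ↦ ContinuousAlternatingMap.ofSubsingleton ℝ _ ℝ (0 : Fin 1) ⟨l x, hc x⟩, ?_⟩
  intro X x hX u
  have h1 := congr($(difference_apply (D := D) (D' := D') hX) u)
  rw [hl, sub_apply, eq_sub_iff_add_eq] at h1
  rw [← h1]
  change _ = _ + l x u • X x + l x (X x) • u
  abel

end TorsionFreeConnection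

end ProjectiveEquivalence

/-! ### Metric connections -/

section MetricConnections

/-- The form `B` identifies `E` with its dual and conjugates `R` to minus its transpose, so the
trace of `R` equals its own negative. -/
theorem LinearMap.trace_eq_zero_of_skew {E : Type*} [AddCommGroup E] [Module ℝ E]
    [FiniteDimensional ℝ E] (B : E →ₗ[ℝ] E →ₗ[ℝ] ℝ) (hB : ∀ v, v ≠ 0 → B v v ≠ 0)
    (R : E →ₗ[ℝ] E) (hR : ∀ v w, B (R v) w + B v (R w) = 0) : LinearMap.trace ℝ E R = 0 := by
  have hinj : Function.Injective B := by
    rw [← LinearMap.ker_eq_bot, LinearMap.ker_eq_bot']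
    intro v hv
    by_contra h
    exact hB v h (by rw [hv, LinearMap.zero_apply])
  have hsurj : Function.Surjective B :=
    (LinearMap.injective_iff_surjective_of_finrank_eq_finrank
      (Subspace.dual_finrank_eq (K := ℝ) (V := E)).symm).1 hinj
  let e : E ≃ₗ[ℝ] Module.Dual ℝ E := LinearEquiv.ofBijective B ⟨hinj, hsurj⟩
  have he : e.conj R + Module.Dual.transpose (R := ℝ) R = 0 := by
    ext φ w
    obtain ⟨v, rfl⟩ := e.surjective φ
    rw [LinearMap.add_apply, LinearEquiv.conj_apply_apply, e.symm_apply_apply]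
    exact hR v w
  have h := LinearMap.trace_conj' R e
  have h1 := congrArg (LinearMap.trace ℝ (Module.Dual ℝ E)) he
  rw [LinearMap.map_zero, LinearMap.map_add, h, LinearMap.trace_transpose'] at h1
  linarith

theorem fderiv_clm_apply_const {𝔼 E F : Type*} [NormedAddCommGroup 𝔼] [NormedSpace ℝ 𝔼]
    [NormedAddCommGroup E] [NormedSpace ℝ E] [NormedAddCommGroup F] [NormedSpace ℝ F]
    {L : 𝔼 → E →L[ℝ] F} {y : 𝔼} (hL : DifferentiableAt ℝ L y) (v : E) (s : 𝔼) :
    fderiv ℝ (fun z ↦ L z v) y s = fderiv ℝ L y s v := by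
  rw [fderiv_clm_apply hL (differentiableAt_const v)]
  simp

/-- If the derivative of a family `G` of symmetric bilinear forms is given by `Γ`, then the
curvature of `Γ` is skew with respect to `G`. -/
theorem apply_add_apply_eq_zero_of_fderiv_eq {E : Type*} [NormedAddCommGroup E] [NormedSpace ℝ E]
    {G : E → E →L[ℝ] E →L[ℝ] ℝ} {Γ : E → E →L[ℝ] E →L[ℝ] E} {y : E}
    (hGs : ContDiffAt ℝ ∞ G y) (hΓ : DifferentiableAt ℝ Γ y)
    (hfd : ∀ᶠ z in 𝓝 y, ∀ u v w, fderiv ℝ G z u v w = G z (Γ z v u) w + G z v (Γ z w u))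
    (s u v w : E) :
    G y (fderiv ℝ Γ y s v u - fderiv ℝ Γ y u v s + (Γ y (Γ y v u) s - Γ y (Γ y v s) u)) w +
      G y v (fderiv ℝ Γ y s w u - fderiv ℝ Γ y u w s +
        (Γ y (Γ y w u) s - Γ y (Γ y w s) u)) = 0 := by
  have hG : DifferentiableAt ℝ G y := hGs.differentiableAt (by simp)
  have hf : ContDiffAt ℝ ∞ (fun z ↦ G z v w) y :=
    (hGs.clm_apply contDiffAt_const).clm_apply contDiffAt_const
  have hf2 : DifferentiableAt ℝ (fderiv ℝ fun z ↦ G z v w) y :=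
    (hf.fderiv_right (m := 1) (WithTop.coe_le_coe.2 le_top)).differentiableAt (by simp)
  have hc : ∀ v : E, DifferentiableAt ℝ (fun _ : E ↦ v) y := differentiableAt_const
  have hΓ1 : ∀ v, DifferentiableAt ℝ (fun z ↦ Γ z v) y := fun v ↦ hΓ.clm_apply (hc v)
  have hΓ2 : ∀ v u, DifferentiableAt ℝ (fun z ↦ Γ z v u) y := fun v u ↦ (hΓ1 v).clm_apply (hc u)
  have hΓ3 : ∀ v u s, fderiv ℝ (fun z ↦ Γ z v u) y s = fderiv ℝ Γ y s v u := fun v u s ↦ by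
    rw [fderiv_clm_apply_const (hΓ1 v), fderiv_clm_apply_const hΓ]
  have hGd : ∀ᶠ z in 𝓝 y, DifferentiableAt ℝ G z := by
    have h1 : ContDiffAt ℝ 1 G y := hGs.of_le (WithTop.coe_le_coe.2 le_top)
    filter_upwards [h1.eventually (by simp)] with z hz
    exact hz.differentiableAt (by simp)
  -- Obtained by differentiating `hfd` once more and substituting it for the derivatives of `G`. The
  -- mixed products of two values of `Γ` are together symmetric in `s`, `u`, so equality of the
  -- second derivatives in both orders leaves exactly the skewness of the curvature.
  have hsecond : ∀ s u, fderiv ℝ (fderiv ℝ fun z ↦ G z v w) y s u =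
      G y (Γ y (Γ y v u) s) w + G y (Γ y v u) (Γ y w s) + G y (fderiv ℝ Γ y s v u) w +
        G y (Γ y v s) (Γ y w u) + G y v (Γ y (Γ y w u) s) + G y v (fderiv ℝ Γ y s w u) := by
    intro s u
    have hev : (fun z ↦ fderiv ℝ (fun z ↦ G z v w) z u) =ᶠ[𝓝 y] fun z ↦
        G z (Γ z v u) w + G z v (Γ z w u) := by
      filter_upwards [hfd, hGd] with z hz hGz
      rw [← hz u v w, fderiv_clm_apply_const (hGz.clm_apply (differentiableAt_const v)),
        fderiv_clm_apply_const hGz]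
    have h2 := hG.clm_apply (hΓ2 v u)
    have h3 := hG.clm_apply (hc v)
    rw [← fderiv_clm_apply_const hf2, hev.fderiv_eq,
      fderiv_fun_add (h2.clm_apply (hc w)) (h3.clm_apply (hΓ2 w u)), add_apply,
      fderiv_clm_apply_const h2, fderiv_clm_apply hG (hΓ2 v u), fderiv_clm_apply h3 (hΓ2 w u)]
    simp only [add_apply, ContinuousLinearMap.comp_apply, ContinuousLinearMap.flip_apply, hΓ3,
      fderiv_clm_apply_const hG, hfd.self_of_nhds]
    ring
  have h1 := (hf.isSymmSndFDerivAt minSmoothness_two_le_infty).eq s u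
  rw [hsecond, hsecond] at h1
  simp only [map_add, map_sub, add_apply, sub_apply]
  linarith

variable {n : ℕ} {M : Type*} [TopologicalSpace M] [ChartedSpace (EuclideanSpace ℝ (Fin n)) M]
  [IsManifold (𝓡 n) ∞ M]

/-- The components of a metric in the chart centred at `x₀`. -/
def chartMetric (g : ContMDiffRiemannianMetric (𝓡 n) ∞ (EuclideanSpace ℝ (Fin n))
      (TangentSpace (𝓡 n) : M → Type _)) (x₀ : M) (y : EuclideanSpace ℝ (Fin n)) :
    EuclideanSpace ℝ (Fin n) →L[ℝ] EuclideanSpace ℝ (Fin n) →L[ℝ] ℝ :=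
  LinearMap.toContinuousBilinearMap (LinearMap.mk₂ ℝ
    (fun v w ↦ g.inner ((extChartAt (𝓡 n) x₀).symm y) (chartPush x₀ y v) (chartPush x₀ y w))
    (fun w w' u ↦ by simp only [map_add, add_apply])
    (fun c w u ↦ by simp only [map_smul, smul_apply])
    (fun w u u' ↦ by simp only [map_add])
    (fun c w u ↦ by simp only [map_smul]))

variable {g : ContMDiffRiemannianMetric (𝓡 n) ∞ (EuclideanSpace ℝ (Fin n))
      (TangentSpace (𝓡 n) : M → Type _)}

theorem contMDiffAt_inner_chartFrame (x₀ : M) {p : M} (hp : p ∈ (extChartAt (𝓡 n) x₀).source)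
    (v w : EuclideanSpace ℝ (Fin n)) :
    ContMDiffAt (𝓡 n) 𝓘(ℝ, ℝ) ∞
      (fun q ↦ g.inner q (chartFrame x₀ v q) (chartFrame x₀ w q)) p := by
  have h : ContMDiffAt (𝓡 n) ((𝓡 n).prod 𝓘(ℝ)) ∞
      (fun q ↦ TotalSpace.mk' ℝ (E := Bundle.Trivial M ℝ) q
        (g.inner q (chartFrame x₀ v q) (chartFrame x₀ w q))) p := by
    apply ContMDiffAt.clm_bundle_apply₂ (F₁ := EuclideanSpace ℝ (Fin n))
      (F₂ := EuclideanSpace ℝ (Fin n))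
    · exact g.contMDiff.contMDiffAt
    · exact contMDiffAt_chartFrame x₀ hp v
    · exact contMDiffAt_chartFrame x₀ hp w
  simp only [contMDiffAt_totalSpace] at h
  exact h.2

theorem chartMetric_apply (x₀ : M) {y : EuclideanSpace ℝ (Fin n)}
    (hy : y ∈ (extChartAt (𝓡 n) x₀).target) (v w : EuclideanSpace ℝ (Fin n)) :
    chartMetric g x₀ y v w = g.inner ((extChartAt (𝓡 n) x₀).symm y)
      (chartFrame x₀ v _) (chartFrame x₀ w _) := by
  rw [chartFrame_apply_symm x₀ hy, chartFrame_apply_symm x₀ hy]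
  rfl

theorem contDiffOn_chartMetric (x₀ : M) :
    ContDiffOn ℝ ∞ (chartMetric g x₀) (extChartAt (𝓡 n) x₀).target := by
  rw [contDiffOn_clm_apply]
  intro v
  rw [contDiffOn_clm_apply]
  intro w y hy
  have h := (contMDiffAt_inner_chartFrame (g := g) x₀ ((extChartAt (𝓡 n) x₀).map_target hy)
    v w).comp y (contMDiffAt_symm_extChartAt x₀ hy)
  exact (contMDiffAt_iff_contDiffAt.1 h).contDiffWithinAt.congr_of_mem
    (fun z hz ↦ chartMetric_apply x₀ hz v w) hy

namespace TorsionFreeConnection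

variable {D : TorsionFreeConnection n M}

theorem IsLeviCivita.fderiv_chartMetric (h : D.IsLeviCivita g) (x₀ : M)
    {y : EuclideanSpace ℝ (Fin n)} (hy : y ∈ (extChartAt (𝓡 n) x₀).target)
    (u v w : EuclideanSpace ℝ (Fin n)) :
    fderiv ℝ (chartMetric g x₀) y u v w =
      chartMetric g x₀ y (D.christoffel x₀ y v u) w +
        chartMetric g x₀ y v (D.christoffel x₀ y w u) := by
  have hp := (extChartAt (𝓡 n) x₀).map_target hy
  have hU := (isOpen_extChartAt_target x₀).mem_nhds hy
  have hG : DifferentiableAt ℝ (chartMetric g x₀) y :=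
    ((contDiffOn_chartMetric x₀).contDiffAt hU).differentiableAt (by simp)
  have h1 : fderiv ℝ (fun z ↦ chartMetric g x₀ z v w) y u =
      fderiv ℝ (chartMetric g x₀) y u v w := by
    rw [fderiv_clm_apply (hG.clm_apply (differentiableAt_const v)) (differentiableAt_const w),
      fderiv_clm_apply hG (differentiableAt_const v)]
    simp
  have hev : (fun z ↦ chartMetric g x₀ z v w) =ᶠ[𝓝 y] fun z ↦
      (fun q ↦ g.inner q (chartFrame x₀ v q) (chartFrame x₀ w q))
        ((extChartAt (𝓡 n) x₀).symm z) := by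
    filter_upwards [hU] with z hz
    exact chartMetric_apply x₀ hz v w
  have hcov : ∀ v : EuclideanSpace ℝ (Fin n),
      D.cov (chartFrame x₀ v) _ (chartPush x₀ y u) =
        chartPush x₀ y (D.christoffel x₀ y v u) := by
    intro v
    rw [← D.chartPull_cov_chartFrame x₀ hy, chartPush_chartPull x₀ hy]
  rw [← h1, hev.fderiv_eq, (fderiv_comp_extChartAt_symm x₀ hy
      ((contMDiffAt_inner_chartFrame x₀ hp v w).mdifferentiableAt (by simp)) u).2,
    h _ _ _ (differentiableFieldAt_chartFrame x₀ hp v) (differentiableFieldAt_chartFrame x₀ hp w),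
    hcov, hcov, chartFrame_apply_symm x₀ hy, chartFrame_apply_symm x₀ hy]
  rfl

/-- The curvature endomorphism of the pair `s`, `u` is skew for the metric, hence traceless. Its
quadratic part is the commutator of `Γ s` and `Γ u`, also traceless, so the part containing
derivatives has trace zero too. -/
theorem IsLeviCivita.trace_curvature_eq_zero [T2Space M] (h : D.IsLeviCivita g) (x₀ : M)
    {y : EuclideanSpace ℝ (Fin n)} (hy : y ∈ (extChartAt (𝓡 n) x₀).target)
    (s u : EuclideanSpace ℝ (Fin n)) :
    traceCLM _ (fderiv ℝ (D.christoffel x₀) y s u) -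
      traceCLM _ (fderiv ℝ (D.christoffel x₀) y u s) = 0 := by
  have hU := (isOpen_extChartAt_target x₀).mem_nhds hy
  have hGs := (contDiffOn_chartMetric (g := g) x₀).contDiffAt hU
  have hskew := apply_add_apply_eq_zero_of_fderiv_eq hGs (D.differentiableAt_christoffel x₀ hy)
    (Filter.mem_of_superset hU fun z hz u v w ↦ h.fderiv_chartMetric x₀ hz u v w) s u
  let Γ : EuclideanSpace ℝ (Fin n) → EuclideanSpace ℝ (Fin n) →ₗ[ℝ] EuclideanSpace ℝ (Fin n) :=
    fun v ↦ (D.christoffel x₀ y v).toLinearMap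
  let R : EuclideanSpace ℝ (Fin n) →ₗ[ℝ] EuclideanSpace ℝ (Fin n) :=
    (fderiv ℝ (D.christoffel x₀) y s u).toLinearMap -
      (fderiv ℝ (D.christoffel x₀) y u s).toLinearMap + (Γ s ∘ₗ Γ u - Γ u ∘ₗ Γ s)
  have hRv : ∀ v, R v = fderiv ℝ (D.christoffel x₀) y s v u - fderiv ℝ (D.christoffel x₀) y u v s +
      (D.christoffel x₀ y (D.christoffel x₀ y v u) s -
        D.christoffel x₀ y (D.christoffel x₀ y v s) u) := by
    intro v
    rw [D.fderiv_christoffel_symm x₀ hy s v u, D.fderiv_christoffel_symm x₀ hy u v s,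
      D.christoffel_symm x₀ hy (D.christoffel x₀ y v u) s,
      D.christoffel_symm x₀ hy (D.christoffel x₀ y v s) u, D.christoffel_symm x₀ hy v u,
      D.christoffel_symm x₀ hy v s]
    rfl
  have htr : LinearMap.trace ℝ _ R = 0 := by
    refine LinearMap.trace_eq_zero_of_skew (LinearMap.mk₂ ℝ (fun v w ↦ chartMetric g x₀ y v w)
      (fun w w' u ↦ by simp only [map_add, add_apply])
      (fun c w u ↦ by simp only [map_smul, smul_apply])
      (fun w u u' ↦ by simp only [map_add])
      (fun c w u ↦ by simp only [map_smul])) (fun v hv ↦ ?_) R (fun v w ↦ ?_)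
    · refine (g.pos _ (chartPush x₀ y v) fun h0 ↦ hv ?_).ne'
      rw [← chartPull_chartPush x₀ hy v, h0, map_zero]
    · simp only [LinearMap.mk₂_apply, hRv]
      exact hskew v w
  have hcomm := LinearMap.trace_comp_comm' (R := ℝ) (Γ s) (Γ u)
  simp only [R, map_add, map_sub] at htr
  rw [hcomm, sub_self, add_zero] at htr
  exact htr

theorem IsMetric.beta_eq_zero [T2Space M] (hn : 2 ≤ n) (h : D.IsMetric) : D.beta = 0 := by
  obtain ⟨g, hg⟩ := h
  funext x
  have hx := mem_extChartAt_target (I := 𝓡 n) x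
  have hb : formInChart D.beta x (extChartAt (𝓡 n) x x) = 0 := by
    ext m
    rw [D.beta_chartPush hn x hx, hg.trace_curvature_eq_zero x hx, mul_zero]
    rfl
  rw [← formInChart_comp_chartPull D.beta x, hb]
  rfl

end TorsionFreeConnection

end MetricConnections

/-! ### Cohomology classes and the main theorem -/

theorem deRhamClass_eq_of_eq_add {n : ℕ} {M : Type*} [TopologicalSpace M]
    [ChartedSpace (EuclideanSpace ℝ (Fin n)) M] {α α' : FormField n M 2}
    (hα : α ∈ closedForms n M 2) (hα' : α' ∈ closedForms n M 2) {Υ : FormField n M 1}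
    (hΥ : Υ ∈ smoothForms n M 1) (h : α' = α + formExtDeriv Υ) :
    deRhamClass α' hα' = deRhamClass α hα := by
  refine (Submodule.Quotient.eq _).2 ⟨Υ, hΥ, ?_⟩
  change _ = α' - α
  rw [h, add_sub_cancel_left]

theorem mainTheorem12 (n : ℕ) (hn : 2 ≤ n) (M : Type*) [TopologicalSpace M]
    [ChartedSpace (EuclideanSpace ℝ (Fin n)) M] [IsManifold (𝓡 n) ∞ M]
    [T2Space M] [SecondCountableTopology M] :
    ∃ hclosed : ∀ D : TorsionFreeConnection n M, D.beta ∈ closedForms n M 2,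
      (∀ (D D' : TorsionFreeConnection n M), ∀ Υ ∈ smoothForms n M 1,
        D.IsProjectiveChange D' Υ → D'.beta = D.beta + formExtDeriv Υ) ∧
      (∀ D D' : TorsionFreeConnection n M, D.ProjectivelyEquivalent D' →
        (∃ Υ ∈ smoothForms n M 1,
          D.IsProjectiveChange D' Υ ∧ D'.beta = D.beta + formExtDeriv Υ) ∧
        deRhamClass D'.beta (hclosed D') = deRhamClass D.beta (hclosed D)) ∧
      (∀ D : TorsionFreeConnection n M,
        (∃ D' : TorsionFreeConnection n M, D.ProjectivelyEquivalent D' ∧ D'.IsMetric) →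
          deRhamClass D.beta (hclosed D) = 0) := by
  have hclosed : ∀ D : TorsionFreeConnection n M, D.beta ∈ closedForms n M 2 :=
    fun D ↦ D.beta_mem_closedForms hn
  have hclass : ∀ D D' : TorsionFreeConnection n M, D.ProjectivelyEquivalent D' →
      (∃ Υ ∈ smoothForms n M 1,
        D.IsProjectiveChange D' Υ ∧ D'.beta = D.beta + formExtDeriv Υ) ∧
      deRhamClass D'.beta (hclosed D') = deRhamClass D.beta (hclosed D) := by
    intro D D' h
    obtain ⟨Υ, hΥ⟩ := h.1.exists_isProjectiveChange
    exact ⟨⟨Υ, hΥ.mem_smoothForms, hΥ, hΥ.beta_eq hn⟩,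
      deRhamClass_eq_of_eq_add _ _ hΥ.mem_smoothForms (hΥ.beta_eq hn)⟩
  refine ⟨hclosed, fun D D' Υ _ h ↦ h.beta_eq hn, hclass, ?_⟩
  rintro D ⟨D', h, hm⟩
  -- The class is computed on the metric connection, whose form vanishes identically.
  rw [← (hclass D D' h).2]
  refine (Submodule.Quotient.mk_eq_zero _).2 ?_
  change D'.beta ∈ exactForms n M 1
  rw [hm.beta_eq_zero hn]
  exact zero_mem _

end
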